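/- Let $N,k,d$ be non-negative integers with $k\le N$, put $n=N+k$, and let $V_\sigma$ ($\sigma\in S(n)$) be the operators permuting the tensor factors of $(\mathbb C^d)^{\otimes n}$. Let $\mathcal A$ be the algebra generated by the operators $V_\sigma^{t_{N+1}\cdots t_n}$, $\sigma\in S(n)$, where $t_s$ is the partial transposition on the $s$-th factor. Let $$V^{(k)}=V^{t_n}_{N-k+1,n}\,V^{t_{n-1}}_{N-k+2,n-1}\cdots V^{t_{N+1}}_{N,N+1},$$ where $V_{r,s}$ is the swap of the factors $r$ and $s$, and let $\mathcal M$ be the two-sided ideal of $\mathcal A$ generated by $V^{(k)}$. For each Young diagram $\mu$ with $m\le N$ boxes let $\phi^\mu$ be a unitary matrix irrep of $S(m)$ labelled by $\mu$ (isomorphic to the Specht module of $\mu$), with rows and columns indexed by the paths in Young's lattice from the empty diagram to $\mu$, and assume that these irreps are in partially reduced (PRIR) form: restricted to $S(m-1)$, $\phi^\mu$ is the block diagonal sum of the $\phi^\kappa$ over the diagrams $\kappa$ obtained from $\mu$ by removing one box, an index of $\phi^\kappa$ being identified with the path that it extends to. For $\mu\vdash N$ and indices $i,j$ of $\phi^\mu$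 put $$E^\mu_{ij}=\frac{d_\mu}{N!}\sum_{\tau\in S(N)}\phi^\mu_{ji}(\tau^{-1})V_\tau ,$$ acting on the first $N$ factors, where $d_\mu=\dim\phi^\mu$. Let $m_\mu$ (resp. $m_\alpha$) be the multiplicity of $\phi^\mu$ in $(\mathbb C^d)^{\otimes N}$ for $\mu\vdash N$ (resp. of $\phi^\alpha$ in $(\mathbb C^d)^{\otimes (N-k)}$ for $\alpha\vdash N-k$). Fix for each $\alpha$ an index $1_\alpha$ of $\phi^\alpha$. For a path $r$ in Young's lattice from $\alpha\vdash N-k$ to $\mu\vdash N$, let $(r,1_\alpha)$ be the index of $\phi^\mu$ obtained by continuing the path $1_\alpha$ along $r$. For paths $r$ from $\alpha$ to $\mu$ and $s$ from $\alpha$ to $\nu$, put $$F^{r\,s}_{i\,j}=\frac{m_\alpha}{\sqrt{m_\mu m_\nu}}\;E^\mu_{i,(r,1_\alpha)}\,V^{(k)}\,E^\nu_{(s,1_\alpha),j},\qquad F_\mu(\alpha)=\sum_{r}\sum_{i}F^{r\,r}_{i\,i},$$ where $r$ runs over all paths from $\alpha$ to $\mu$ and $i$ over all indices of $\phi^\mu$.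 Consider the pairs $(\alpha,\mu)$ of Young diagrams with at most $d$ rows such that $\alpha\vdash N-k$, $\mu\vdash N$ and $\alpha\subseteq\mu$. Then each $F_\mu(\alpha)$ is a (Hermitian) projector, $F_\mu(\alpha)F_\nu(\beta)=0$ whenever $(\alpha,\mu)\ne(\beta,\nu)$, and $$\sum_{\alpha}\sum_{\mu\supseteq\alpha}F_\mu(\alpha)=\mathbf 1_{\mathcal M},$$ that is, this sum lies in $\mathcal M$ and is a two-sided identity for all elements of $\mathcal M$. -/

import Mathlib

open Equiv

/-! ### Paths in Young's lattice -/

/-- Paths from `α` up to `μ` in Young's lattice: chains of Young diagrams in which every diagram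
covers the previous one, i.e. arises from it by adding one box. -/
inductive YoungPath (α : YoungDiagram) : YoungDiagram → Type
  | nil : YoungPath α α
  | cons {κ μ : YoungDiagram} (p : YoungPath α κ) (h : κ ⋖ μ) : YoungPath α μ

namespace YoungPath

/-- Concatenation of a path from `α` to `β` with a path from `β` to `γ`. -/
def comp {α β : YoungDiagram} (p : YoungPath α β) :
    {γ : YoungDiagram} → YoungPath β γ → YoungPath α γ
  | _, nil => p
  | _, cons q h => cons (p.comp q) h

/-- Removal of the last step of a path. -/
def unsnoc {α : YoungDiagram} : {μ : YoungDiagram} → YoungPath α μ →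
    Option (Σ κ : {κ : YoungDiagram // κ ⋖ μ}, YoungPath α κ.1)
  | _, nil => none
  | _, cons p h => some ⟨⟨_, h⟩, p⟩

theorem unsnoc_injective {α μ : YoungDiagram} :
    Function.Injective (unsnoc : YoungPath α μ → _) := by
  intro p q hpq
  cases p with
  | nil =>
    cases q with
    | nil => rfl
    | cons q h => simp [unsnoc] at hpq
  | cons p h =>
    cases q with
    | nil => simp [unsnoc] at hpq
    | cons q h' =>
      simp only [unsnoc, Option.some.injEq, Sigma.mk.injEq, Subtype.mk.injEq] at hpq
      obtain ⟨h1, h2⟩ := hpq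
      subst h1
      simp at h2
      subst h2
      rfl

end YoungPath

theorem YoungDiagram.finite_Iic (μ : YoungDiagram) : (Set.Iic μ).Finite := by
  apply Set.Finite.of_finite_image (f := YoungDiagram.cells)
  · apply (Finset.finite_toSet μ.cells.powerset).subset
    rintro _ ⟨κ, hκ, rfl⟩
    simpa using YoungDiagram.cells_subset_iff.2 hκ
  · intro a _ b _ h
    exact YoungDiagram.ext h

theorem YoungPath.finite (α : YoungDiagram) :
    ∀ (n : ℕ) (μ : YoungDiagram), μ.card ≤ n → Finite (YoungPath α μ)
  | n, μ, hn => by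
    have hlt : ∀ κ : YoungDiagram, κ ⋖ μ → κ.card < μ.card := fun κ h =>
      Finset.card_lt_card (YoungDiagram.cells_ssubset_iff.2 h.lt)
    have h1 : Finite {κ : YoungDiagram // κ ⋖ μ} :=
      (μ.finite_Iic.subset (fun κ (h : κ ⋖ μ) => h.le)).to_subtype
    have h2 : ∀ κ : {κ : YoungDiagram // κ ⋖ μ}, Finite (YoungPath α κ.1) := fun κ =>
      match n, hn with
      | 0, hn => absurd (hlt κ.1 κ.2) (by omega)
      | n + 1, hn => YoungPath.finite α n κ.1 (by have := hlt κ.1 κ.2; omega)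
    exact Finite.of_injective _ (YoungPath.unsnoc_injective (α := α) (μ := μ))

noncomputable instance (α μ : YoungDiagram) : Fintype (YoungPath α μ) :=
  haveI := YoungPath.finite α μ.card μ le_rfl
  Fintype.ofFinite _

noncomputable instance (α μ : YoungDiagram) : DecidableEq (YoungPath α μ) := Classical.decEq _

/-- The basis indices of the irrep labelled by `μ`: paths from the empty diagram to `μ`
(equivalently, standard Young tableaux of shape `μ`). -/
abbrev YoungIndex (μ : YoungDiagram) : Type := YoungPath ⊥ μ

theorem finite_youngDiagrams (m d : ℕ) :
    {μ : YoungDiagram | μ.card = m ∧ μ.colLen 0 ≤ d}.Finite := by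
  apply Set.Finite.of_finite_image (f := YoungDiagram.cells)
  · apply (Finset.finite_toSet (Finset.range m ×ˢ Finset.range m).powerset).subset
    rintro _ ⟨μ, ⟨hμ, -⟩, rfl⟩
    simp only [Finset.coe_powerset, Set.mem_preimage, Set.mem_powerset_iff, Finset.coe_subset]
    rintro ⟨i, j⟩ hij
    have hsub : Finset.range (i + 1) ×ˢ Finset.range (j + 1) ⊆ μ.cells := by
      rintro ⟨a, b⟩ hab
      simp only [Finset.mem_product, Finset.mem_range] at hab
      exact μ.up_left_mem (by omega) (by omega) hij
    have hcard := Finset.card_le_card hsub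
    simp only [Finset.card_product, Finset.card_range] at hcard
    change _ ≤ μ.card at hcard
    simp only [Finset.mem_product, Finset.mem_range]
    constructor <;> nlinarith
  · intro a _ b _ h
    exact YoungDiagram.ext h

/-- The Young diagrams with `m` boxes and at most `d` rows. -/
noncomputable def youngDiagrams (m d : ℕ) : Finset YoungDiagram :=
  (finite_youngDiagrams m d).toFinset

open Classical in
/-- The Young diagrams with `m` boxes and at most `d` rows that contain `α`. -/
noncomputable def youngDiagramsAbove (α : YoungDiagram) (m d : ℕ) : Finset YoungDiagram :=
  (youngDiagrams m d).filter fun μ => α ≤ μ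

/-! ### Irreps of the symmetric groups and partially reduced (PRIR) bases -/

open Classical in
/-- The Young symmetrizer of the filling `t` of the boxes of `μ` with `0, …, m - 1`: the sum of
all permutations preserving the rows, times the signed sum of all those preserving the columns. -/
noncomputable def youngSymmetrizer {m : ℕ} {μ : YoungDiagram} (t : Fin m ≃ μ.cells) :
    MonoidAlgebra ℂ (Perm (Fin m)) :=
  (∑ p : Perm (Fin m) with ∀ i, (t (p i)).1.1 = (t i).1.1, MonoidAlgebra.single p 1) *
    ∑ q : Perm (Fin m) with ∀ i, (t (q i)).1.2 = (t i).1.2,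
      MonoidAlgebra.single q ((Perm.sign q : ℤ) : ℂ)

/-- The linear representation defined by a unitary matrix representation. -/
noncomputable def matrixRep {G ι : Type} [Group G] [Fintype ι] [DecidableEq ι]
    (ρ : G →* Matrix.unitaryGroup ι ℂ) : Representation ℂ G (ι → ℂ) :=
  (Matrix.toLinAlgEquiv' : Matrix ι ι ℂ ≃ₐ[ℂ] _).toAlgHom.toMonoidHom.comp
    ((Matrix.unitaryGroup ι ℂ).subtype.comp ρ)

/-- `ρ` is (isomorphic to) the irrep of the symmetric group labelled by `μ`: it is irreducible and
isomorphic to the Specht module, the left ideal of the group algebra generated by a Young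
symmetrizer of shape `μ`. -/
def IsIrrepOfShape {m : ℕ} {ι : Type} [Fintype ι] [DecidableEq ι] (μ : YoungDiagram)
    (ρ : Perm (Fin m) →* Matrix.unitaryGroup ι ℂ) : Prop :=
  (matrixRep ρ).IsIrreducible ∧
  ∃ (t : Fin m ≃ μ.cells) (f : (ι → ℂ) →ₗ[ℂ] MonoidAlgebra ℂ (Perm (Fin m))),
    Function.Injective f ∧
    LinearMap.range f = (Ideal.span {youngSymmetrizer t}).restrictScalars ℂ ∧
    ∀ (σ : Perm (Fin m)) (v : ι → ℂ),
      f (matrixRep ρ σ v) = MonoidAlgebra.single σ 1 * f v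

/-- A family of candidate matrix representations `φ m μ` of `S(m)`, with rows and columns indexed
by paths. Only the members with `μ` a diagram with `m` boxes are ever used. -/
abbrev MatrixFamily : Type :=
  (m : ℕ) → (μ : YoungDiagram) → Perm (Fin m) →* Matrix.unitaryGroup (YoungIndex μ) ℂ

/-- The family `φ` consists, for all Young diagrams `μ` with `m ≤ N` boxes, of unitary irreps of
`S(m)` labelled by `μ` in partially reduced (PRIR) form: restricted to `S(m)`, the irrep of
`S(m + 1)` labelled by `μ` is the block diagonal sum of the irreps labelled by the diagrams `κ`
covered by `μ`, the index `p.cons h` being the index `p` of the block of `κ`. -/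
structure IsPRIR (N : ℕ) (φ : MatrixFamily) : Prop where
  irrep : ∀ (m : ℕ) (μ : YoungDiagram), m ≤ N → μ.card = m → IsIrrepOfShape μ (φ m μ)
  restrict_same : ∀ (m : ℕ) (μ κ : YoungDiagram) (h : κ ⋖ μ), m + 1 ≤ N → μ.card = m + 1 →
    ∀ (σ : Perm (Fin m)) (p q : YoungIndex κ),
      (φ (m + 1) μ (σ.viaEmbedding Fin.castSuccEmb)).1 (p.cons h) (q.cons h) = (φ m κ σ).1 p q
  restrict_ne : ∀ (m : ℕ) (μ κ κ' : YoungDiagram) (h : κ ⋖ μ) (h' : κ' ⋖ μ), κ ≠ κ' →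
    m + 1 ≤ N → μ.card = m + 1 →
    ∀ (σ : Perm (Fin m)) (p : YoungIndex κ) (q : YoungIndex κ'),
      (φ (m + 1) μ (σ.viaEmbedding Fin.castSuccEmb)).1 (p.cons h) (q.cons h') = 0

/-! ### Operators on `(ℂ^d)^{⊗ n}`

They are written as matrices in the product basis `e_x = e_{x 0} ⊗ ⋯ ⊗ e_{x (n-1)}`. -/

/-- Operators on the `n`-fold tensor power of `ℂ^d`. -/
abbrev TensorOp (n d : ℕ) : Type := Matrix (Fin n → Fin d) (Fin n → Fin d) ℂ

/-- The operator `V_σ` permuting the tensor factors: it moves the factor at position `i` to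
position `σ i`. -/
def permOp (n d : ℕ) (σ : Perm (Fin n)) : TensorOp n d :=
  Matrix.of fun y x => if y = fun i => x (σ⁻¹ i) then 1 else 0

/-- Partial transposition with respect to the tensor factor `s`. -/
def partialTranspose {n d : ℕ} (s : Fin n) (A : TensorOp n d) : TensorOp n d :=
  Matrix.of fun x y => A (Function.update x s (y s)) (Function.update y s (x s))

/-- Partial transposition with respect to the last `k` of `N + k` tensor factors. -/
def partialTransposeLast (N k : ℕ) {d : ℕ} (A : TensorOp (N + k) d) : TensorOp (N + k) d :=
  (List.finRange k).foldr (fun j B => partialTranspose (Fin.natAdd N j) B) A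

/-- The algebra of partially transposed permutation operators: the algebra generated by the
permutation operators of `N + k` systems, partially transposed on the last `k` systems. -/
def partiallyTransposedAlgebra (N k d : ℕ) : Subalgebra ℂ (TensorOp (N + k) d) :=
  Algebra.adjoin ℂ (Set.range fun σ : Perm (Fin (N + k)) =>
    partialTransposeLast N k (permOp (N + k) d σ))

/-- The operator `V^{(k)}`, the product over `j = 0, …, k - 1` of the partial transposes (on the
second named system) of the swaps of system `N - k + j` with system `N + k - 1 - j`; systems are
numbered from `0`. -/
def contractionOp (N k d : ℕ) : TensorOp (N + k) d :=
  (List.ofFn fun j : Fin k =>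
    partialTranspose ⟨N + k - 1 - j, by omega⟩
      (permOp (N + k) d (Equiv.swap ⟨N - k + j, by omega⟩ ⟨N + k - 1 - j, by omega⟩))).prod

/-- The two-sided ideal `M` of the algebra of partially transposed permutation operators that is
generated by `V^{(k)}`. -/
def maximalIdeal (N k d : ℕ) : Submodule ℂ (TensorOp (N + k) d) :=
  Submodule.span ℂ {x | ∃ a ∈ partiallyTransposedAlgebra N k d,
    ∃ b ∈ partiallyTransposedAlgebra N k d, x = a * contractionOp N k d * b}

/-! ### The operators `E`, `F` and `F_μ(α)` -/

/-- Matrices of the linear maps from the representation space of `φ m μ` to `(ℂ^d)^{⊗ m}` which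
commute with the action of `S(m)`. -/
def intertwiners (φ : MatrixFamily) (m d : ℕ) (μ : YoungDiagram) :
    Submodule ℂ (Matrix (Fin m → Fin d) (YoungIndex μ) ℂ) where
  carrier := {T | ∀ σ : Perm (Fin m), permOp m d σ * T = T * (φ m μ σ).1}
  add_mem' := by
    intro S T hS hT σ
    rw [Matrix.mul_add, Matrix.add_mul, hS σ, hT σ]
  zero_mem' := by
    intro σ
    simp
  smul_mem' := by
    intro c T hT σ
    rw [Matrix.mul_smul, Matrix.smul_mul, hT σ]

/-- The multiplicity `m_μ` of the irrep of `S(m)` labelled by `μ` in `(ℂ^d)^{⊗ m}`. -/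
noncomputable def irrepMultiplicity (φ : MatrixFamily) (m d : ℕ) (μ : YoungDiagram) : ℕ :=
  Module.finrank ℂ (intertwiners φ m d μ)

/-- The operator `E_{ij}^μ = (d_μ / N!) ∑_τ φ^μ_{ji}(τ⁻¹) V_τ`, with `τ` in `S(N)`, acting on the
first `N` of `N + k` systems. -/
noncomputable def opE (φ : MatrixFamily) (N k d : ℕ) (μ : YoungDiagram) (i j : YoungIndex μ) :
    TensorOp (N + k) d :=
  ((Fintype.card (YoungIndex μ) : ℂ) / (N.factorial : ℂ)) •
    ∑ τ : Perm (Fin N), (φ N μ τ⁻¹).1 j i •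
      permOp (N + k) d (τ.viaEmbedding (Fin.castAddEmb k))

/-- The operator `F_{i j}^{r s}`, for paths `r` from `α` to `μ` and `s` from `α` to `ν` and indices
`i` of `μ` and `j` of `ν`. The choice function `one` fixes an index `1_α` of every `α`. -/
noncomputable def opF (φ : MatrixFamily) (one : (α : YoungDiagram) → YoungIndex α) (N k d : ℕ)
    {α μ ν : YoungDiagram} (r : YoungPath α μ) (s : YoungPath α ν)
    (i : YoungIndex μ) (j : YoungIndex ν) : TensorOp (N + k) d :=
  (((irrepMultiplicity φ (N - k) d α : ℝ) /
      Real.sqrt ((irrepMultiplicity φ N d μ : ℝ) * (irrepMultiplicity φ N d ν : ℝ)) : ℝ) : ℂ) •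
    (opE φ N k d μ i ((one α).comp r) * contractionOp N k d * opE φ N k d ν ((one α).comp s) j)

/-- The operator `F_μ(α) = ∑_r ∑_i F_{i i}^{r r}`, summed over all paths `r` from `α` to `μ` and all
indices `i` of `μ`. -/
noncomputable def projF (φ : MatrixFamily) (one : (α : YoungDiagram) → YoungIndex α) (N k d : ℕ)
    (α μ : YoungDiagram) : TensorOp (N + k) d :=
  ∑ r : YoungPath α μ, ∑ i : YoungIndex μ, opF φ one N k d r r i i

/-- The sum of the operators `F_μ(α)` over all `α` with `N - k` boxes and all `μ` with `N` boxes
that contain `α`; only diagrams with at most `d` rows are considered. -/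
noncomputable def sumProjF (φ : MatrixFamily) (one : (α : YoungDiagram) → YoungIndex α)
    (N k d : ℕ) : TensorOp (N + k) d :=
  ∑ α ∈ youngDiagrams (N - k) d, ∑ μ ∈ youngDiagramsAbove α N d, projF φ one N k d α μ

/-!
Writing `W` for the operator that inserts `k` unnormalised maximally entangled pairs, `V^(k)` is
`W Wᴴ`, the compression `Wᴴ (X ⊗ 1) W` is the partial trace of `X` over its last `k` factors, and
`(Y ⊗ 1 ⊗ 1) W = W Y`. A partially transposed permutation maps `(X ⊗ 1) W`, with `X` in the image
of `ℂ[S(N)]`, to some `(X' ⊗ 1) W` of the same form, so every element of the ideal is a linear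
combination of operators `(X ⊗ 1) W Wᴴ b`.

Up to a scalar, `F^{r r}_{i i}` is `A Aᴴ` with `A = (E^μ_{i, (r, 1)} ⊗ 1) W`. The products `Aᴴ A'`
of two such factors are partial traces of matrix units of `ℂ[S(N)]`; by the PRIR form and Schur's
lemma they vanish for different labels, and comparing traces shows that `Aᴴ A` is
`m_μ / m_α • E^α_{1 1}`. So the `F^{r r}_{i i}` are projectors with orthogonal ranges. Their sum is
a left identity because `ℂ[S(N)]` is spanned by the `E^μ_{i j}` (there are `∑ f_μ ^ 2 = N!` of
them), the index `j` continues a path to some `α`, and `E^μ = 0` if `μ` has more than `d` rows.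
Taking adjoints shows that it is a right identity.
-/

/-! ### Matrix units in the group algebra -/

section MatrixUnits

variable {G ι κ : Type} [Group G] [Fintype ι] [DecidableEq ι] [Fintype κ] [DecidableEq κ]
  {ρ : G →* Matrix.unitaryGroup ι ℂ} {ρ' : G →* Matrix.unitaryGroup κ ℂ}

theorem matrixRep_apply (ρ : G →* Matrix.unitaryGroup ι ℂ) (g : G) (v : ι → ℂ) :
    matrixRep ρ g v = (ρ g).1.mulVec v := rfl

theorem coe_unitaryRep_mul (ρ : G →* Matrix.unitaryGroup ι ℂ) (g h : G) :
    (ρ (g * h)).1 = (ρ g).1 * (ρ h).1 := by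
  rw [map_mul, Submonoid.coe_mul]

/-- A matrix commuting with two matrix representations, as an intertwining map. -/
noncomputable def matrixIntertwiningMap (T : Matrix ι κ ℂ)
    (hT : ∀ g, (ρ g).1 * T = T * (ρ' g).1) :
    Representation.IntertwiningMap (matrixRep ρ') (matrixRep ρ) where
  toLinearMap := Matrix.toLin' T
  isIntertwining' g := by
    refine LinearMap.ext fun v => ?_
    simp only [LinearMap.comp_apply, matrixRep_apply, Matrix.toLin'_apply, Matrix.mulVec_mulVec, hT]

theorem eq_zero_of_intertwines (h : (matrixRep ρ).IsIrreducible) (h' : (matrixRep ρ').IsIrreducible)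
    (hne : IsEmpty (Representation.Equiv (matrixRep ρ') (matrixRep ρ))) {T : Matrix ι κ ℂ}
    (hT : ∀ g, (ρ g).1 * T = T * (ρ' g).1) : T = 0 := by
  have hmap : matrixIntertwiningMap T hT = 0 := Subsingleton.elim _ _
  have hlin : Matrix.toLin' T = 0 := congrArg (fun f => f.toLinearMap) hmap
  simpa using hlin

theorem exists_eq_smul_one_of_commutes (h : (matrixRep ρ).IsIrreducible) {T : Matrix ι ι ℂ}
    (hT : ∀ g, (ρ g).1 * T = T * (ρ g).1) : ∃ c : ℂ, T = c • (1 : Matrix ι ι ℂ) := by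
  obtain ⟨c, hc⟩ :=
    (Representation.IsIrreducible.algebraMap_intertwiningMap_bijective_of_isAlgClosed
      (ρ := matrixRep ρ)).2 (matrixIntertwiningMap T hT)
  have hlin : Matrix.toLin' T = c • LinearMap.id := (congrArg (fun f => f.toLinearMap) hc).symm
  refine ⟨c, Matrix.toLin'.injective ?_⟩
  rw [hlin, map_smul, Matrix.toLin'_one]

/-- The extension of a matrix representation to the group algebra. -/
noncomputable def matrixAlgHom (ρ : G →* Matrix.unitaryGroup ι ℂ) :
    MonoidAlgebra ℂ G →ₐ[ℂ] Matrix ι ι ℂ :=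
  MonoidAlgebra.lift ℂ _ _ ((Matrix.unitaryGroup ι ℂ).subtype.comp ρ)

theorem matrixAlgHom_single (ρ : G →* Matrix.unitaryGroup ι ℂ) (g : G) (c : ℂ) :
    matrixAlgHom ρ (MonoidAlgebra.single g c) = c • (ρ g).1 := by
  simp [matrixAlgHom]

theorem map_matrixAlgHom_mulVec {V : Type*} [AddCommGroup V] [Module ℂ V] {f : (ι → ℂ) →ₗ[ℂ] V}
    (F : MonoidAlgebra ℂ G →ₐ[ℂ] Module.End ℂ V)
    (hf : ∀ g v, f (matrixRep ρ g v) = F (MonoidAlgebra.single g 1) (f v))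
    (x : MonoidAlgebra ℂ G) (v : ι → ℂ) :
    f ((matrixAlgHom ρ x).mulVec v) = F x (f v) := by
  induction x using MonoidAlgebra.induction_on with
  | of g => simpa [matrixAlgHom_single, matrixRep_apply] using hf g v
  | add x y hx hy => simp only [map_add, Matrix.add_mulVec, hx, hy, LinearMap.add_apply]
  | smul c x hx => simp only [map_smul, Matrix.smul_mulVec, hx, LinearMap.smul_apply]

theorem matrixAlgHom_eq_zero_of_mulVec {x : MonoidAlgebra ℂ G}
    (hx : ∀ v, (matrixAlgHom ρ x).mulVec v = 0) : matrixAlgHom ρ x = 0 :=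
  Matrix.toLin'.injective <| by ext1; ext1; simp [hx]

theorem matrixAlgHom_eq_zero_of_equiv (e : Representation.Equiv (matrixRep ρ) (matrixRep ρ'))
    {x : MonoidAlgebra ℂ G} (hx : matrixAlgHom ρ' x = 0) : matrixAlgHom ρ x = 0 := by
  refine matrixAlgHom_eq_zero_of_mulVec fun v => EquivLike.injective e ?_
  have he := map_matrixAlgHom_mulVec (ρ := ρ) (f := e.toIntertwiningMap.toLinearMap)
    ((Matrix.toLinAlgEquiv' : Matrix κ κ ℂ ≃ₐ[ℂ] _).toAlgHom.comp (matrixAlgHom ρ'))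
    (fun g v => by
      simpa [matrixAlgHom_single, matrixRep_apply] using
        Representation.IntertwiningMap.isIntertwining _ _ e.toIntertwiningMap g v) x v
  rw [map_zero]
  simpa [hx] using he

variable [Fintype G]

/-- The sum of the conjugates of a matrix under the group: the projection onto intertwiners, up
to the factor `|G|`. -/
noncomputable def groupTwirl (ρ : G →* Matrix.unitaryGroup ι ℂ) (ρ' : G →* Matrix.unitaryGroup κ ℂ)
    (X : Matrix ι κ ℂ) : Matrix ι κ ℂ :=
  ∑ h, (ρ h).1 * X * (ρ' h⁻¹).1

theorem mul_groupTwirl (X : Matrix ι κ ℂ) (g : G) :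
    (ρ g).1 * groupTwirl ρ ρ' X = groupTwirl ρ ρ' X * (ρ' g).1 := by
  rw [groupTwirl, Matrix.mul_sum, Matrix.sum_mul]
  refine Fintype.sum_equiv (Equiv.mulLeft g) _ _ fun h => ?_
  have hinv : (ρ' h⁻¹).1 = (ρ' (g * h)⁻¹).1 * (ρ' g).1 := by
    rw [← coe_unitaryRep_mul]
    simp
  simp only [Equiv.coe_mulLeft, coe_unitaryRep_mul, hinv, Matrix.mul_assoc]

theorem groupTwirl_single_apply (i j : ι) (k l : κ) :
    groupTwirl ρ ρ' (Matrix.single j k 1) i l = ∑ h, (ρ h).1 i j * (ρ' h⁻¹).1 k l := by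
  rw [groupTwirl, Matrix.sum_apply]
  refine Finset.sum_congr rfl fun h _ => ?_
  rw [Matrix.mul_assoc, Matrix.mul_apply, Finset.sum_eq_single j]
  · simp
  · intro b _ hb
    simp [hb]
  · simp

theorem groupTwirl_eq_zero (h : (matrixRep ρ).IsIrreducible) (h' : (matrixRep ρ').IsIrreducible)
    (hne : IsEmpty (Representation.Equiv (matrixRep ρ') (matrixRep ρ))) (X : Matrix ι κ ℂ) :
    groupTwirl ρ ρ' X = 0 :=
  eq_zero_of_intertwines h h' hne (mul_groupTwirl X)

theorem trace_groupTwirl (ρ : G →* Matrix.unitaryGroup ι ℂ) (X : Matrix ι ι ℂ) :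
    (groupTwirl ρ ρ X).trace = Fintype.card G * X.trace := by
  have hconj : ∀ g, ((ρ g).1 * X * (ρ g⁻¹).1).trace = X.trace := fun g => by
    rw [Matrix.trace_mul_comm, ← Matrix.mul_assoc, ← coe_unitaryRep_mul]
    simp
  rw [groupTwirl, Matrix.trace_sum, Finset.sum_congr rfl fun g _ => hconj g]
  simp

theorem card_smul_groupTwirl (h : (matrixRep ρ).IsIrreducible) (X : Matrix ι ι ℂ) :
    (Fintype.card ι : ℂ) • groupTwirl ρ ρ X = (Fintype.card G * X.trace) • 1 := by
  obtain ⟨c, hc⟩ := exists_eq_smul_one_of_commutes h (mul_groupTwirl X)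
  have htrace := trace_groupTwirl ρ X
  rw [hc, Matrix.trace_smul, Matrix.trace_one, smul_eq_mul] at htrace
  rw [hc, smul_smul, mul_comm, htrace]

/-- The element of the group algebra which acts as the matrix unit `(i, j)` in the unitary
irreducible representation `ρ`. -/
noncomputable def matrixUnit (ρ : G →* Matrix.unitaryGroup ι ℂ) (i j : ι) : MonoidAlgebra ℂ G :=
  ((Fintype.card ι : ℂ) / Fintype.card G) • ∑ τ : G, MonoidAlgebra.single τ ((ρ τ⁻¹).1 j i)

theorem coeff_matrixUnit (ρ : G →* Matrix.unitaryGroup ι ℂ) (i j : ι) (τ : G) :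
    (matrixUnit ρ i j).coeff τ = (Fintype.card ι / Fintype.card G) * (ρ τ⁻¹).1 j i := by
  classical
  simp [matrixUnit, MonoidAlgebra.coeff_single, Finsupp.single_apply]

theorem single_mul_matrixUnit (ρ : G →* Matrix.unitaryGroup ι ℂ) (g : G) (i j : ι) :
    MonoidAlgebra.single g 1 * matrixUnit ρ i j = ∑ k, (ρ g).1 k i • matrixUnit ρ k j := by
  ext τ
  have hτ : (g⁻¹ * τ)⁻¹ = τ⁻¹ * g := by group
  simp [coeff_matrixUnit, hτ, Matrix.mul_apply, Finset.mul_sum,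
    Finsupp.finsetSum_apply, mul_left_comm, mul_comm]

theorem matrixUnit_mul_single (ρ : G →* Matrix.unitaryGroup ι ℂ) (g : G) (i j : ι) :
    matrixUnit ρ i j * MonoidAlgebra.single g 1 = ∑ k, (ρ g).1 j k • matrixUnit ρ i k := by
  ext τ
  have hτ : (τ * g⁻¹)⁻¹ = g * τ⁻¹ := by group
  simp [coeff_matrixUnit, hτ, Matrix.mul_apply, Finset.mul_sum,
    Finsupp.finsetSum_apply, mul_left_comm]

theorem mul_matrixUnit (ρ : G →* Matrix.unitaryGroup ι ℂ) (x : MonoidAlgebra ℂ G) (i j : ι) :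
    x * matrixUnit ρ i j = ∑ k, matrixAlgHom ρ x k i • matrixUnit ρ k j := by
  induction x using MonoidAlgebra.induction_on with
  | of g => simpa [matrixAlgHom_single] using single_mul_matrixUnit ρ g i j
  | add x y hx hy => simp only [map_add, add_mul, hx, hy, Matrix.add_apply, add_smul,
      Finset.sum_add_distrib]
  | smul c x hx => simp only [map_smul, smul_mul_assoc, hx, Matrix.smul_apply, Finset.smul_sum,
      smul_smul, smul_eq_mul]

theorem matrixUnit_mul (ρ : G →* Matrix.unitaryGroup ι ℂ) (i j : ι) (x : MonoidAlgebra ℂ G) :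
    matrixUnit ρ i j * x = ∑ k, matrixAlgHom ρ x j k • matrixUnit ρ i k := by
  induction x using MonoidAlgebra.induction_on with
  | of g => simpa [matrixAlgHom_single] using matrixUnit_mul_single ρ g i j
  | add x y hx hy => simp only [map_add, mul_add, hx, hy, Matrix.add_apply, add_smul,
      Finset.sum_add_distrib]
  | smul c x hx => simp only [map_smul, mul_smul_comm, hx, Matrix.smul_apply, Finset.smul_sum,
      smul_smul, smul_eq_mul]

theorem matrixAlgHom_matrixUnit_apply (ρ : G →* Matrix.unitaryGroup ι ℂ)
    (ρ' : G →* Matrix.unitaryGroup κ ℂ) (i j : ι) (k l : κ) :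
    matrixAlgHom ρ' (matrixUnit ρ i j) k l =
      (Fintype.card ι / Fintype.card G) * groupTwirl ρ' ρ (Matrix.single l j 1) k i := by
  simp only [matrixUnit, map_smul, map_sum, matrixAlgHom_single, Matrix.smul_apply,
    Matrix.sum_apply, smul_eq_mul, groupTwirl_single_apply, mul_comm]

theorem matrixAlgHom_matrixUnit_self (h : (matrixRep ρ).IsIrreducible) (i j : ι) :
    matrixAlgHom ρ (matrixUnit ρ i j) = Matrix.single i j 1 := by
  ext k l
  have hschur := congrFun (congrFun (card_smul_groupTwirl h (Matrix.single l j 1)) k) i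
  simp only [Matrix.smul_apply, smul_eq_mul] at hschur
  have hcard : (Fintype.card G : ℂ) ≠ 0 := by simp
  rw [matrixAlgHom_matrixUnit_apply, div_mul_eq_mul_div, hschur, mul_assoc,
    mul_div_cancel_left₀ _ hcard]
  by_cases hjl : j = l
  · subst hjl
    simp [Matrix.single_apply, Matrix.one_apply, eq_comm]
  · simp [hjl, Matrix.trace_single_eq_of_ne _ _ _ (Ne.symm hjl)]

theorem matrixAlgHom_matrixUnit_of_isEmpty_equiv (h : (matrixRep ρ).IsIrreducible)
    (h' : (matrixRep ρ').IsIrreducible)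
    (hne : IsEmpty (Representation.Equiv (matrixRep ρ) (matrixRep ρ'))) (i j : ι) :
    matrixAlgHom ρ' (matrixUnit ρ i j) = 0 := by
  ext k l
  rw [matrixAlgHom_matrixUnit_apply, groupTwirl_eq_zero h' h hne, Matrix.zero_apply, mul_zero,
    Matrix.zero_apply]

theorem matrixUnit_mul_matrixUnit (h : (matrixRep ρ).IsIrreducible) (i j k l : ι) :
    matrixUnit ρ i j * matrixUnit ρ k l = if j = k then matrixUnit ρ i l else 0 := by
  rw [matrixUnit_mul, matrixAlgHom_matrixUnit_self h]
  by_cases hjk : j = k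
  · subst hjk
    simp [Matrix.single_apply, ite_smul]
  · simp [hjk, Ne.symm hjk]

theorem matrixUnit_mul_matrixUnit_of_isEmpty_equiv (h : (matrixRep ρ).IsIrreducible)
    (h' : (matrixRep ρ').IsIrreducible)
    (hne : IsEmpty (Representation.Equiv (matrixRep ρ) (matrixRep ρ'))) (i j : ι) (k l : κ) :
    matrixUnit ρ i j * matrixUnit ρ' k l = 0 := by
  simp [mul_matrixUnit, matrixAlgHom_matrixUnit_of_isEmpty_equiv h h' hne]

theorem matrixUnit_mul_mul_matrixUnit (h : (matrixRep ρ).IsIrreducible) (x : MonoidAlgebra ℂ G)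
    (i j k l : ι) :
    matrixUnit ρ i j * x * matrixUnit ρ k l = matrixAlgHom ρ x j k • matrixUnit ρ i l := by
  simp [matrixUnit_mul, Finset.sum_mul, matrixUnit_mul_matrixUnit h]

theorem matrixUnit_mul_mul_matrixUnit_of_isEmpty_equiv (h : (matrixRep ρ).IsIrreducible)
    (h' : (matrixRep ρ').IsIrreducible)
    (hne : IsEmpty (Representation.Equiv (matrixRep ρ) (matrixRep ρ'))) (x : MonoidAlgebra ℂ G)
    (i j : ι) (k l : κ) : matrixUnit ρ i j * x * matrixUnit ρ' k l = 0 := by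
  simp [matrixUnit_mul, Finset.sum_mul, matrixUnit_mul_matrixUnit_of_isEmpty_equiv h h' hne]

theorem linearIndependent_matrixUnit {I : Type*} {ι : I → Type} [∀ a, Fintype (ι a)]
    [∀ a, DecidableEq (ι a)] {ρ : ∀ a, G →* Matrix.unitaryGroup (ι a) ℂ}
    (h : ∀ a, (matrixRep (ρ a)).IsIrreducible)
    (hne : ∀ a b, a ≠ b → IsEmpty (Representation.Equiv (matrixRep (ρ a)) (matrixRep (ρ b)))) :
    LinearIndependent ℂ fun x : Σ a, ι a × ι a => matrixUnit (ρ x.1) x.2.1 x.2.2 := by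
  rw [linearIndependent_iff']
  rintro s c hc ⟨a, i, j⟩ hs
  have hentry := congrFun (congrFun (congrArg (matrixAlgHom (ρ a)) hc) i) j
  simp only [map_sum, map_smul, Matrix.sum_apply, Matrix.smul_apply, map_zero,
    Matrix.zero_apply] at hentry
  rw [Finset.sum_eq_single_of_mem _ hs] at hentry
  · simpa [matrixAlgHom_matrixUnit_self (h a)] using hentry
  · rintro ⟨b, i', j'⟩ - hb
    by_cases hab : a = b
    · subst hab
      rw [matrixAlgHom_matrixUnit_self (h a), Matrix.single_apply_of_ne, smul_zero]
      rintro ⟨rfl, rfl⟩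
      exact hb rfl
    · rw [matrixAlgHom_matrixUnit_of_isEmpty_equiv (h b) (h a) (hne b a (Ne.symm hab)),
        Matrix.zero_apply, smul_zero]

end MatrixUnits

/-! ### Young symmetrizers -/

section SignedSum

variable {G : Type*} [Group G]

theorem coeff_mul_one_comm (x y : MonoidAlgebra ℂ G) : (x * y).coeff 1 = (y * x).coeff 1 := by
  induction x using MonoidAlgebra.induction_on with
  | of g => simp
  | add x x' hx hx' => simp [add_mul, mul_add, hx, hx']
  | smul c x hx => simp [hx]

variable [Fintype G]

theorem coeff_mul_one (x y : MonoidAlgebra ℂ G) :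
    (x * y).coeff 1 = ∑ g, x.coeff g * y.coeff g⁻¹ := by
  classical
  induction x using MonoidAlgebra.induction_on with
  | of g => simp [Finsupp.single_apply]
  | add x x' hx hx' => simp [add_mul, hx, hx', Finset.sum_add_distrib]
  | smul c x hx => simp [hx, Finset.mul_sum, mul_assoc]

open Classical in
/-- The sum of the elements of the subgroup `H`, weighted by the character `ε`. -/
noncomputable def signedSum (H : Subgroup G) (ε : G →* ℤˣ) : MonoidAlgebra ℂ G :=
  ∑ h : G with h ∈ H, MonoidAlgebra.single h ((ε h : ℤ) : ℂ)

variable {H K : Subgroup G}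

theorem intUnits_cast_mul_self (u : ℤˣ) : ((u : ℤ) : ℂ) * ((u : ℤ) : ℂ) = 1 := by
  exact_mod_cast Int.units_coe_mul_self u

open Classical in
theorem coeff_signedSum (H : Subgroup G) (ε : G →* ℤˣ) (g : G) :
    (signedSum H ε).coeff g = if g ∈ H then ((ε g : ℤ) : ℂ) else 0 := by
  simp [signedSum, MonoidAlgebra.coeff_single, Finsupp.single_apply]

theorem single_mul_signedSum (ε : G →* ℤˣ) {h : G} (hh : h ∈ H) :
    MonoidAlgebra.single h 1 * signedSum H ε = ((ε h : ℤ) : ℂ) • signedSum H ε := by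
  ext g
  have hmem : h⁻¹ * g ∈ H ↔ g ∈ H := H.mul_mem_cancel_left (inv_mem hh)
  by_cases hg : g ∈ H <;> simp [coeff_signedSum, hmem, hg]

theorem signedSum_mul_single (ε : G →* ℤˣ) {h : G} (hh : h ∈ H) :
    signedSum H ε * MonoidAlgebra.single h 1 = ((ε h : ℤ) : ℂ) • signedSum H ε := by
  ext g
  have hmem : g * h⁻¹ ∈ H ↔ g ∈ H := H.mul_mem_cancel_right (inv_mem hh)
  by_cases hg : g ∈ H <;> simp [coeff_signedSum, hmem, hg, mul_comm]

theorem signedSum_mul_self (H : Subgroup G) (ε : G →* ℤˣ) :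
    signedSum H ε * signedSum H ε = (Nat.card H : ℂ) • signedSum H ε := by
  classical
  have habsorb : ∀ h ∈ Finset.univ.filter (· ∈ H),
      MonoidAlgebra.single h ((ε h : ℤ) : ℂ) * signedSum H ε = signedSum H ε := by
    intro h hh
    have hsmul : MonoidAlgebra.single h ((ε h : ℤ) : ℂ) =
        ((ε h : ℤ) : ℂ) • MonoidAlgebra.single h 1 := by simp
    rw [hsmul, smul_mul_assoc, single_mul_signedSum ε (Finset.mem_filter.1 hh).2, smul_smul,
      intUnits_cast_mul_self, one_smul]
  conv_lhs => enter [1]; rw [signedSum]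
  rw [Finset.sum_mul, Finset.sum_congr rfl habsorb, Finset.sum_const, Nat.cast_smul_eq_nsmul,
    Nat.card_eq_fintype_card, Fintype.card_subtype]

theorem coeff_signedSum_mul_signedSum_one (hHK : H ⊓ K = ⊥) (ε η : G →* ℤˣ) :
    (signedSum H ε * signedSum K η).coeff 1 = 1 := by
  have hmem : ∀ g, g ∈ H → g ∈ K → g = 1 := fun g hH hK =>
    Subgroup.mem_bot.1 (hHK ▸ Subgroup.mem_inf.2 ⟨hH, hK⟩)
  rw [coeff_mul_one, Finset.sum_eq_single 1]
  · simp [coeff_signedSum]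
  · intro g _ hg
    by_cases hH : g ∈ H <;> by_cases hK : g ∈ K
    · exact absurd (hmem g hH hK) hg
    all_goals simp [coeff_signedSum, hH, hK]
  · simp

/-- The coefficient at `1` is cyclic, and `signedSum K η` is idempotent up to the factor `|K|`. -/
theorem signedSum_mul_mul_signedSum_ne_zero (hHK : H ⊓ K = ⊥) (ε η : G →* ℤˣ) :
    signedSum K η * (signedSum H ε * signedSum K η) ≠ 0 := by
  intro hzero
  have hcoeff : (signedSum K η * (signedSum H ε * signedSum K η)).coeff 1 = (Nat.card K : ℂ) := by
    rw [coeff_mul_one_comm, mul_assoc, signedSum_mul_self, mul_smul_comm, MonoidAlgebra.coeff_smul,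
      Finsupp.smul_apply, coeff_signedSum_mul_signedSum_one hHK, smul_eq_mul, mul_one]
  rw [hzero] at hcoeff
  exact Nat.cast_ne_zero.2 (Nat.card_pos (α := K)).ne' hcoeff.symm

end SignedSum

section YoungSymmetrizer

/-- The group of permutations preserving the fibres of `f`. -/
def fiberPerm {α β : Type*} (f : α → β) : Subgroup (Perm α) where
  carrier := {p | ∀ i, f (p i) = f i}
  mul_mem' hp hq i := (hp _).trans (hq i)
  one_mem' _ := rfl
  inv_mem' {p} hp i := by simpa using (hp (p⁻¹ i)).symm

theorem mem_fiberPerm {α β : Type*} {f : α → β} {p : Perm α} :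
    p ∈ fiberPerm f ↔ ∀ i, f (p i) = f i := Iff.rfl

theorem swap_mem_fiberPerm {α β : Type*} [DecidableEq α] {f : α → β} {x y : α} (h : f x = f y) :
    swap x y ∈ fiberPerm f :=
  Equiv.apply_swap_eq_self h

variable {m : ℕ} {μ ν : YoungDiagram}

/-- The sum of all permutations preserving the rows of a filling. -/
noncomputable def rowSymmetrizer (t : Fin m ≃ μ.cells) : MonoidAlgebra ℂ (Perm (Fin m)) :=
  signedSum (fiberPerm fun i => (t i).1.1) 1

/-- The signed sum of all permutations preserving the columns of a filling. -/
noncomputable def colAntisymmetrizer (t : Fin m ≃ μ.cells) : MonoidAlgebra ℂ (Perm (Fin m)) :=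
  signedSum (fiberPerm fun i => (t i).1.2) Perm.sign

theorem youngSymmetrizer_eq (t : Fin m ≃ μ.cells) :
    youngSymmetrizer t = rowSymmetrizer t * colAntisymmetrizer t := by
  simp [youngSymmetrizer, rowSymmetrizer, colAntisymmetrizer, signedSum, mem_fiberPerm]

theorem fiberPerm_row_inf_fiberPerm_col (t : Fin m ≃ μ.cells) :
    (fiberPerm fun i => (t i).1.1) ⊓ (fiberPerm fun i => (t i).1.2) = ⊥ := by
  refine (Subgroup.eq_bot_iff_forall _).2 fun p hp => Equiv.ext fun i => ?_
  exact t.injective (Subtype.ext (Prod.ext (hp.1 i) (hp.2 i)))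

theorem colAntisymmetrizer_mul_youngSymmetrizer_ne_zero (t : Fin m ≃ μ.cells) :
    colAntisymmetrizer t * youngSymmetrizer t ≠ 0 := by
  rw [youngSymmetrizer_eq]
  exact signedSum_mul_mul_signedSum_ne_zero (fiberPerm_row_inf_fiberPerm_col t) _ _

theorem rowSymmetrizer_mul_youngSymmetrizer_ne_zero (t : Fin m ≃ μ.cells) :
    rowSymmetrizer t * youngSymmetrizer t ≠ 0 := by
  intro hzero
  rw [youngSymmetrizer_eq, ← mul_assoc, rowSymmetrizer, signedSum_mul_self, smul_mul_assoc,
    smul_eq_zero_iff_right (Nat.cast_ne_zero.2 Nat.card_pos.ne')] at hzero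
  apply colAntisymmetrizer_mul_youngSymmetrizer_ne_zero t
  rw [youngSymmetrizer_eq, rowSymmetrizer, hzero, mul_zero]

/-- The transposition of `x` and `y` fixes the row symmetrizer and negates the column
antisymmetrizer. -/
theorem rowSymmetrizer_mul_single_mul_colAntisymmetrizer (t : Fin m ≃ μ.cells)
    (s : Fin m ≃ ν.cells) (g : Perm (Fin m)) {x y : Fin m} (hxy : x ≠ y)
    (hrow : (t x).1.1 = (t y).1.1) (hcol : (s (g⁻¹ x)).1.2 = (s (g⁻¹ y)).1.2) :
    rowSymmetrizer t * (MonoidAlgebra.single g 1 * colAntisymmetrizer s) = 0 := by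
  have hR : rowSymmetrizer t * MonoidAlgebra.single (swap x y) 1 = rowSymmetrizer t := by
    have := signedSum_mul_single (1 : Perm (Fin m) →* ℤˣ)
      (swap_mem_fiberPerm (f := fun i => (t i).1.1) hrow)
    simpa [rowSymmetrizer] using this
  have hC : MonoidAlgebra.single (swap (g⁻¹ x) (g⁻¹ y)) 1 * colAntisymmetrizer s =
      -colAntisymmetrizer s := by
    have := single_mul_signedSum Perm.sign (swap_mem_fiberPerm (f := fun i => (s i).1.2) hcol)
    rwa [Perm.sign_swap (by simpa using hxy), Units.val_neg, Units.val_one, Int.cast_neg,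
      Int.cast_one, neg_one_smul] at this
  have hswap : MonoidAlgebra.single (swap x y) (1 : ℂ) * MonoidAlgebra.single g 1 =
      MonoidAlgebra.single g 1 * MonoidAlgebra.single (swap (g⁻¹ x) (g⁻¹ y)) 1 := by
    rw [MonoidAlgebra.single_mul_single, MonoidAlgebra.single_mul_single, mul_swap_eq_swap_mul]
    simp
  have := IsAddTorsionFree.of_isTorsionFree ℂ (MonoidAlgebra ℂ (Perm (Fin m)))
  refine self_eq_neg.1 ?_
  calc rowSymmetrizer t * (MonoidAlgebra.single g 1 * colAntisymmetrizer s)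
      = rowSymmetrizer t * (MonoidAlgebra.single g 1 *
          (MonoidAlgebra.single (swap (g⁻¹ x) (g⁻¹ y)) 1 * colAntisymmetrizer s)) := by
        conv_lhs => rw [← hR, mul_assoc, ← mul_assoc (MonoidAlgebra.single _ _), hswap, mul_assoc]
    _ = -(rowSymmetrizer t * (MonoidAlgebra.single g 1 * colAntisymmetrizer s)) := by
        rw [hC, mul_neg, mul_neg]

variable {ι : Type} [Fintype ι] [DecidableEq ι] {ρ : Perm (Fin m) →* Matrix.unitaryGroup ι ℂ}

theorem IsIrrepOfShape.exists_matrixAlgHom_eq_zero_iff (h : IsIrrepOfShape μ ρ) :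
    ∃ t : Fin m ≃ μ.cells, ∀ x, matrixAlgHom ρ x = 0 ↔ ∀ y, x * (y * youngSymmetrizer t) = 0 := by
  obtain ⟨-, t, f, hinj, hrange, hf⟩ := h
  refine ⟨t, fun x => ?_⟩
  have hact : ∀ v, f ((matrixAlgHom ρ x).mulVec v) = x * f v :=
    map_matrixAlgHom_mulVec (Algebra.lmul ℂ _) hf x
  have hmem : ∀ z, z ∈ LinearMap.range f ↔ ∃ y, y * youngSymmetrizer t = z := fun z => by
    rw [hrange, Submodule.restrictScalars_mem, Ideal.mem_span_singleton']
  constructor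
  · intro hx y
    obtain ⟨v, hv⟩ := (hmem _).2 ⟨y, rfl⟩
    rw [← hv, ← hact, hx, Matrix.zero_mulVec, map_zero]
  · refine fun hx => matrixAlgHom_eq_zero_of_mulVec fun v => hinj ?_
    obtain ⟨y, hy⟩ := (hmem (f v)).1 ⟨v, rfl⟩
    rw [hact, map_zero, ← hy, hx]

theorem IsIrrepOfShape.exists_matrixAlgHom_colAntisymmetrizer_ne_zero (h : IsIrrepOfShape μ ρ) :
    ∃ t : Fin m ≃ μ.cells, matrixAlgHom ρ (colAntisymmetrizer t) ≠ 0 := by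
  obtain ⟨t, ht⟩ := h.exists_matrixAlgHom_eq_zero_iff
  refine ⟨t, fun hzero => colAntisymmetrizer_mul_youngSymmetrizer_ne_zero t ?_⟩
  simpa using (ht _).1 hzero 1

end YoungSymmetrizer

/-! ### Irreps of different shapes are inequivalent -/

section Dominance

variable {m : ℕ} {μ ν : YoungDiagram}

/-- The boxes of `μ` in the rows above row `i`. -/
def firstRows (μ : YoungDiagram) (i : ℕ) : Finset (ℕ × ℕ) :=
  μ.cells.filter fun c => c.1 < i

theorem firstRows_filter_col (ν : YoungDiagram) (i c : ℕ) :
    (firstRows ν i).filter (fun a => a.2 = c) =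
      (Finset.range (min i (ν.colLen c))).image fun a => (a, c) := by
  ext ⟨a, b⟩
  simp only [firstRows, Finset.mem_filter, YoungDiagram.mem_cells, Finset.mem_image,
    Finset.mem_range, lt_min_iff, Prod.mk.injEq, YoungDiagram.mem_iff_lt_colLen]
  constructor
  · rintro ⟨⟨hb, ha⟩, rfl⟩
    exact ⟨a, ⟨ha, hb⟩, rfl, rfl⟩
  · rintro ⟨_, ⟨ha, hb⟩, rfl, rfl⟩
    exact ⟨⟨hb, ha⟩, rfl⟩

theorem card_firstRows_eq_sum_min (ν : YoungDiagram) (i : ℕ) :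
    (firstRows ν i).card = ∑ c ∈ ν.cells.image Prod.snd, min i (ν.colLen c) := by
  rw [Finset.card_eq_sum_card_fiberwise (f := Prod.snd) (t := ν.cells.image Prod.snd)]
  · refine Finset.sum_congr rfl fun c _ => ?_
    rw [firstRows_filter_col, Finset.card_image_of_injective _ (Prod.mk_left_injective c),
      Finset.card_range]
  · intro a ha
    exact Finset.mem_image_of_mem _ (Finset.mem_filter.1 ha).1

theorem card_filter_row_lt (u : Fin m ≃ μ.cells) (i : ℕ) :
    (Finset.univ.filter fun x => (u x).1.1 < i).card = (firstRows μ i).card := by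
  refine Finset.card_bij (fun x _ => (u x).1) (fun x hx => ?_) (fun x _ y _ hxy => ?_)
    fun c hc => ?_
  · simpa [firstRows] using hx
  · exact u.injective (Subtype.ext hxy)
  · rw [firstRows, Finset.mem_filter] at hc
    exact ⟨u.symm ⟨c, hc.1⟩, by simpa using hc.2, by simp⟩

/-- If no two entries share both a row of `u` and a column of `v`, then every column of `v` holds
at most `i` of the entries in the first `i` rows of `u`. -/
theorem card_firstRows_le_of_separated (u : Fin m ≃ μ.cells) (v : Fin m ≃ ν.cells)
    (h : ∀ x y, (u x).1.1 = (u y).1.1 → (v x).1.2 = (v y).1.2 → x = y) (i : ℕ) :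
    (firstRows μ i).card ≤ (firstRows ν i).card := by
  rw [← card_filter_row_lt u, card_firstRows_eq_sum_min,
    Finset.card_eq_sum_card_fiberwise (f := fun x => (v x).1.2) (t := ν.cells.image Prod.snd)
      fun x _ => Finset.mem_image_of_mem _ (v x).2]
  refine Finset.sum_le_sum fun c _ => le_min ?_ ?_
  · rw [← Finset.card_range i]
    refine Finset.card_le_card_of_injOn (fun x => (u x).1.1) (fun x hx => ?_)
      fun x hx y hy hxy => ?_
    · simp only [Finset.coe_filter, Finset.mem_filter, Finset.mem_univ, true_and,
        Set.mem_ofPred_eq] at hx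
      simpa using hx.1
    · simp only [Finset.coe_filter, Set.mem_ofPred_eq] at hx hy
      exact h x y hxy (hx.2.trans hy.2.symm)
  · rw [← Finset.card_range (ν.colLen c)]
    refine Finset.card_le_card_of_injOn (fun x => (v x).1.1) (fun x hx => ?_)
      fun x hx y hy hxy => ?_
    · simp only [Finset.coe_filter, Set.mem_ofPred_eq] at hx
      rw [Finset.coe_range, Set.mem_Iio, ← YoungDiagram.mem_iff_lt_colLen, ← hx.2]
      exact (v x).2
    · simp only [Finset.coe_filter, Set.mem_ofPred_eq] at hx hy
      exact v.injective (Subtype.ext (Prod.ext hxy (hx.2.trans hy.2.symm)))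

theorem card_firstRows_succ (μ : YoungDiagram) (i : ℕ) :
    (firstRows μ (i + 1)).card = (firstRows μ i).card + μ.rowLen i := by
  rw [YoungDiagram.rowLen_eq_card, ← Finset.card_union_of_disjoint]
  · congr 1
    ext c
    simp only [firstRows, Finset.mem_filter, Finset.mem_union, YoungDiagram.mem_row_iff,
      YoungDiagram.mem_cells, Nat.lt_succ_iff_lt_or_eq]
    tauto
  · refine Finset.disjoint_left.2 fun c hc hc' => ?_
    exact (Finset.mem_filter.1 hc).2.ne (YoungDiagram.mem_row_iff.1 hc').2

theorem eq_of_card_firstRows_eq (h : ∀ i, (firstRows μ i).card = (firstRows ν i).card) :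
    μ = ν := by
  refine SetLike.ext fun ⟨a, b⟩ => ?_
  have hrow := h (a + 1)
  rw [card_firstRows_succ, card_firstRows_succ, h a, Nat.add_left_cancel_iff] at hrow
  rw [YoungDiagram.mem_iff_lt_rowLen, YoungDiagram.mem_iff_lt_rowLen, hrow]

theorem rowSymmetrizer_mul_mul_colAntisymmetrizer_of_card_lt (t : Fin m ≃ μ.cells)
    (s : Fin m ≃ ν.cells) {i : ℕ} (hlt : (firstRows ν i).card < (firstRows μ i).card)
    (z : MonoidAlgebra ℂ (Perm (Fin m))) :
    rowSymmetrizer t * (z * colAntisymmetrizer s) = 0 := by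
  induction z using MonoidAlgebra.induction_on with
  | of g =>
    obtain ⟨x, y, hrow, hcol, hxy⟩ :
        ∃ x y, (t x).1.1 = (t y).1.1 ∧ (s (g⁻¹ x)).1.2 = (s (g⁻¹ y)).1.2 ∧ x ≠ y := by
      by_contra! hsep
      exact hlt.not_ge (card_firstRows_le_of_separated t ((g⁻¹ : Perm (Fin m)).trans s) hsep i)
    exact rowSymmetrizer_mul_single_mul_colAntisymmetrizer t s g hxy hrow hcol
  | add x y hx hy => rw [add_mul, mul_add, hx, hy, add_zero]
  | smul c x hx => rw [smul_mul_assoc, mul_smul_comm, hx, smul_zero]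

variable {ι κ : Type} [Fintype ι] [DecidableEq ι] [Fintype κ] [DecidableEq κ]
  {ρ : Perm (Fin m) →* Matrix.unitaryGroup ι ℂ} {ρ' : Perm (Fin m) →* Matrix.unitaryGroup κ ℂ}

theorem IsIrrepOfShape.card_firstRows_le (h : IsIrrepOfShape μ ρ) (h' : IsIrrepOfShape ν ρ')
    (e : Representation.Equiv (matrixRep ρ) (matrixRep ρ')) (i : ℕ) :
    (firstRows μ i).card ≤ (firstRows ν i).card := by
  obtain ⟨t, ht⟩ := h.exists_matrixAlgHom_eq_zero_iff
  obtain ⟨s, hs⟩ := h'.exists_matrixAlgHom_eq_zero_iff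
  by_contra! hlt
  have hrow : matrixAlgHom ρ' (rowSymmetrizer t) = 0 := (hs _).2 fun y => by
    rw [youngSymmetrizer_eq, ← mul_assoc y,
      rowSymmetrizer_mul_mul_colAntisymmetrizer_of_card_lt t s hlt]
  apply rowSymmetrizer_mul_youngSymmetrizer_ne_zero t
  simpa using (ht _).1 (matrixAlgHom_eq_zero_of_equiv e hrow) 1

theorem IsIrrepOfShape.isEmpty_equiv (h : IsIrrepOfShape μ ρ) (h' : IsIrrepOfShape ν ρ')
    (hne : μ ≠ ν) : IsEmpty (Representation.Equiv (matrixRep ρ) (matrixRep ρ')) :=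
  ⟨fun e => hne (eq_of_card_firstRows_eq fun i =>
    le_antisymm (h.card_firstRows_le h' e i) (h'.card_firstRows_le h e.symm i))⟩

end Dominance

/-! ### Counting paths in Young's lattice -/

section ModularLattice

variable {L : Type*} [Lattice L] [IsModularLattice L] {a b c : L}

theorem covBy_and_covBy_iff_eq_sup (hne : a ≠ b) :
    a ⋖ c ∧ b ⋖ c ↔ c = a ⊔ b ∧ a ⊓ b ⋖ a ∧ a ⊓ b ⋖ b := by
  constructor
  · rintro ⟨hac, hbc⟩
    obtain rfl := hac.wcovBy.sup_eq hbc.wcovBy hne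
    exact ⟨rfl, inf_covBy_of_covBy_sup_right hbc, inf_covBy_of_covBy_sup_left hac⟩
  · rintro ⟨rfl, ha, hb⟩
    exact ⟨covBy_sup_of_inf_covBy_right hb, covBy_sup_of_inf_covBy_left ha⟩

theorem covBy_and_covBy_iff_eq_inf (hne : a ≠ b) :
    c ⋖ a ∧ c ⋖ b ↔ c = a ⊓ b ∧ a ⋖ a ⊔ b ∧ b ⋖ a ⊔ b := by
  simpa only [← toDual_inf, ← toDual_sup, toDual_covBy_toDual_iff,
    EmbeddingLike.apply_eq_iff_eq] using
    covBy_and_covBy_iff_eq_sup (L := Lᵒᵈ) (a := OrderDual.toDual a) (b := OrderDual.toDual b)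
      (c := OrderDual.toDual c) hne

theorem sum_upper_lower_covers_comm [DecidableEq L] {M : Type*} [AddCommMonoid M]
    {upper lower : L → Finset L} (mem_upper : ∀ a b, b ∈ upper a ↔ a ⋖ b)
    (mem_lower : ∀ a b, a ∈ lower b ↔ a ⋖ b) (f : L → M) (a : L) :
    ∑ c ∈ upper a, ∑ b ∈ (lower c).erase a, f b =
      ∑ c ∈ lower a, ∑ b ∈ (upper c).erase a, f b := by
  rw [Finset.sum_sigma', Finset.sum_sigma']
  refine Finset.sum_bij' (fun x _ => ⟨a ⊓ x.2, x.2⟩) (fun x _ => ⟨a ⊔ x.2, x.2⟩) ?_ ?_ ?_ ?_ ?_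
  · rintro ⟨c, b⟩ h
    simp only [Finset.mem_sigma, Finset.mem_erase, mem_upper, mem_lower] at h ⊢
    obtain ⟨-, hinf⟩ := (covBy_and_covBy_iff_eq_sup h.2.1.symm).1 ⟨h.1, h.2.2⟩
    exact ⟨hinf.1, h.2.1, hinf.2⟩
  · rintro ⟨c, b⟩ h
    simp only [Finset.mem_sigma, Finset.mem_erase, mem_upper, mem_lower] at h ⊢
    obtain ⟨-, hsup⟩ := (covBy_and_covBy_iff_eq_inf h.2.1.symm).1 ⟨h.1, h.2.2⟩
    exact ⟨hsup.1, h.2.1, hsup.2⟩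
  · rintro ⟨c, b⟩ h
    simp only [Finset.mem_sigma, Finset.mem_erase, mem_upper, mem_lower] at h
    simp only [((covBy_and_covBy_iff_eq_sup h.2.1.symm).1 ⟨h.1, h.2.2⟩).1]
  · rintro ⟨c, b⟩ h
    simp only [Finset.mem_sigma, Finset.mem_erase, mem_upper, mem_lower] at h
    simp only [((covBy_and_covBy_iff_eq_inf h.2.1.symm).1 ⟨h.1, h.2.2⟩).1]
  · intro x _
    rfl

end ModularLattice

section YoungLattice

open YoungDiagram (cells_subset_iff cells_ssubset_iff mem_cells mem_iff_lt_rowLen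
  mem_iff_lt_colLen)

variable {κ μ : YoungDiagram}

/-- Removal of a maximal box. -/
def eraseBox (μ : YoungDiagram) (c : ℕ × ℕ) (hc : ∀ x ∈ μ, c ≤ x → x = c) : YoungDiagram where
  cells := μ.cells.erase c
  isLowerSet := by
    intro a b hba ha
    simp only [Finset.coe_erase, Set.mem_sdiff, Finset.mem_coe, mem_cells, Set.mem_singleton_iff]
      at ha ⊢
    refine ⟨μ.isLowerSet hba ha.1, ?_⟩
    rintro rfl
    exact ha.2 (hc a ha.1 hba)

/-- Addition of a minimal box. -/
def insertBox (μ : YoungDiagram) (c : ℕ × ℕ) (hc : ∀ x, x < c → x ∈ μ) : YoungDiagram where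
  cells := insert c μ.cells
  isLowerSet := by
    intro a b hba ha
    simp only [Finset.coe_insert, Set.mem_insert_iff, Finset.mem_coe, mem_cells] at ha ⊢
    rcases ha with rfl | ha
    · exact hba.eq_or_lt.imp_right (hc b)
    · exact Or.inr (μ.isLowerSet hba ha)

theorem card_eq_of_covBy (h : κ ⋖ μ) : μ.card = κ.card + 1 := by
  have hne : (μ.cells \ κ.cells).Nonempty := Finset.sdiff_nonempty.2 (cells_ssubset_iff.2 h.lt).2
  obtain ⟨c, hc, hcmax⟩ := (μ.cells \ κ.cells).exists_maximal hne
  obtain ⟨hcμ, hcκ⟩ := Finset.mem_sdiff.1 hc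
  have hmax : ∀ x ∈ μ, c ≤ x → x = c := fun x hx hcx =>
    le_antisymm (hcmax (Finset.mem_sdiff.2 ⟨hx, fun hxκ => hcκ (κ.isLowerSet hcx hxκ)⟩) hcx) hcx
  have hle : κ ≤ eraseBox μ c hmax := cells_subset_iff.1 fun x hx =>
    Finset.mem_erase.2 ⟨fun hxc => hcκ (hxc ▸ hx), cells_subset_iff.2 h.le hx⟩
  have hlt : eraseBox μ c hmax < μ := cells_ssubset_iff.1 (Finset.erase_ssubset hcμ)
  obtain rfl : κ = eraseBox μ c hmax := hle.eq_or_lt.resolve_right fun hlt' => h.2 hlt' hlt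
  exact (Finset.card_erase_add_one hcμ).symm

theorem covBy_of_le_of_card_eq (h : κ ≤ μ) (hc : μ.card = κ.card + 1) : κ ⋖ μ := by
  refine ⟨lt_of_le_of_ne h ?_, fun ρ hκρ hρμ => ?_⟩
  · rintro rfl
    omega
  · have hcard_lt {ρ ρ' : YoungDiagram} (hlt : ρ < ρ') : ρ.card < ρ'.card :=
      Finset.card_lt_card (cells_ssubset_iff.2 hlt)
    have := hcard_lt hκρ
    have := hcard_lt hρμ
    omega

theorem exists_cells_eq_insert (h : κ ⋖ μ) : ∃ c, c ∉ κ ∧ μ.cells = insert c κ.cells := by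
  have hsub : κ.cells ⊆ μ.cells := cells_subset_iff.2 h.le
  have hcard : (μ.cells \ κ.cells).card + κ.card = μ.card :=
    Finset.card_sdiff_add_card_eq_card hsub
  have hcov := card_eq_of_covBy h
  obtain ⟨c, hc⟩ := Finset.card_eq_one.1 (show (μ.cells \ κ.cells).card = 1 by omega)
  refine ⟨c, (Finset.mem_sdiff.1 (hc ▸ Finset.mem_singleton_self c)).2, ?_⟩
  rw [← Finset.singleton_union, ← hc, Finset.sdiff_union_of_subset hsub]

theorem mem_youngDiagrams {m d : ℕ} : μ ∈ youngDiagrams m d ↔ μ.card = m ∧ μ.colLen 0 ≤ d := by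
  simp [youngDiagrams]

theorem mem_youngDiagrams_self {m : ℕ} : μ ∈ youngDiagrams m m ↔ μ.card = m := by
  rw [mem_youngDiagrams, and_iff_left_iff_imp]
  rintro rfl
  rw [μ.colLen_eq_card]
  exact Finset.card_le_card (Finset.filter_subset _ _)

open Classical in
/-- The diagrams obtained from `κ` by adding one box. -/
noncomputable def upperCovers (κ : YoungDiagram) : Finset YoungDiagram :=
  (youngDiagrams (κ.card + 1) (κ.card + 1)).filter fun μ => κ ⋖ μ

open Classical in
/-- The diagrams obtained from `μ` by removing one box. -/
noncomputable def lowerCovers (μ : YoungDiagram) : Finset YoungDiagram :=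
  (youngDiagrams (μ.card - 1) (μ.card - 1)).filter fun κ => κ ⋖ μ

@[simp]
theorem mem_upperCovers : μ ∈ upperCovers κ ↔ κ ⋖ μ := by
  simp only [upperCovers, Finset.mem_filter, mem_youngDiagrams_self, and_iff_right_iff_imp]
  exact card_eq_of_covBy

@[simp]
theorem mem_lowerCovers : κ ∈ lowerCovers μ ↔ κ ⋖ μ := by
  simp only [lowerCovers, Finset.mem_filter, mem_youngDiagrams_self, and_iff_right_iff_imp]
  intro h
  have := card_eq_of_covBy h
  omega

/-- The rows of `κ` to which a box can be added. -/
def addableRows (κ : YoungDiagram) : Finset ℕ :=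
  (Finset.range (κ.colLen 0 + 1)).filter fun i => i = 0 ∨ κ.rowLen i < κ.rowLen (i - 1)

/-- The rows of `κ` from which a box can be removed. -/
def removableRows (κ : YoungDiagram) : Finset ℕ :=
  (Finset.range (κ.colLen 0)).filter fun i => κ.rowLen (i + 1) < κ.rowLen i

theorem card_addableRows (κ : YoungDiagram) :
    (addableRows κ).card = (removableRows κ).card + 1 := by
  have h : addableRows κ = insert 0 ((removableRows κ).map ⟨Nat.succ, Nat.succ_injective⟩) := by
    ext i
    rcases i with _ | i <;> simp [addableRows, removableRows]
  rw [h, Finset.card_insert_of_notMem (by simp), Finset.card_map]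

theorem mem_of_lt_of_mem_addableRows {i : ℕ} (hi : i ∈ addableRows κ) :
    ∀ x, x < (i, κ.rowLen i) → x ∈ κ := by
  rintro ⟨a, b⟩ hab
  simp only [addableRows, Finset.mem_filter] at hi
  rw [mem_iff_lt_rowLen]
  rcases Prod.mk_lt_mk.1 hab with ⟨hai, hb⟩ | ⟨hai, hb⟩
  · have := κ.rowLen_anti a (i - 1) (by omega)
    omega
  · exact hb.trans_le (κ.rowLen_anti a i hai)

theorem rowEnd_mem_of_mem_removableRows {i : ℕ} (hi : i ∈ removableRows κ) :
    (i, κ.rowLen i - 1) ∈ κ := by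
  simp only [removableRows, Finset.mem_filter] at hi
  rw [mem_iff_lt_rowLen]
  omega

theorem eq_of_le_of_mem_removableRows {i : ℕ} (hi : i ∈ removableRows κ) :
    ∀ x ∈ κ, (i, κ.rowLen i - 1) ≤ x → x = (i, κ.rowLen i - 1) := by
  rintro ⟨a, b⟩ hab h
  simp only [removableRows, Finset.mem_filter] at hi
  rw [Prod.mk_le_mk] at h
  rw [mem_iff_lt_rowLen] at hab
  obtain rfl : a = i := by
    by_contra hne
    have := κ.rowLen_anti (i + 1) a (by omega)
    omega
  rw [Prod.mk_inj]
  omega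

theorem exists_mem_addableRows_of_covBy (h : κ ⋖ μ) :
    ∃ i ∈ addableRows κ, μ.cells = insert (i, κ.rowLen i) κ.cells := by
  obtain ⟨⟨i, j⟩, hc, hμ⟩ := exists_cells_eq_insert h
  have mem_μ : ∀ x, x ∈ μ ↔ x = (i, j) ∨ x ∈ κ := by
    intro x
    rw [← mem_cells, hμ, Finset.mem_insert, mem_cells]
  have hij : (i, j) ∈ μ := (mem_μ _).2 (Or.inl rfl)
  rw [mem_iff_lt_rowLen, not_lt] at hc
  obtain rfl : j = κ.rowLen i := by
    by_contra hne
    have := (mem_μ (i, j - 1)).1 (μ.up_left_mem le_rfl (by omega) hij)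
    rw [mem_iff_lt_rowLen, Prod.mk_inj] at this
    omega
  refine ⟨i, ?_, hμ⟩
  simp only [addableRows, Finset.mem_filter, Finset.mem_range]
  rcases i with _ | i
  · simp
  · have hprev : (i, κ.rowLen (i + 1)) ∈ κ :=
      ((mem_μ _).1 (μ.up_left_mem (by omega) le_rfl hij)).resolve_left (by simp)
    have hfirst : i < κ.colLen 0 :=
      mem_iff_lt_colLen.1 (κ.up_left_mem le_rfl (Nat.zero_le _) hprev)
    rw [mem_iff_lt_rowLen] at hprev
    exact ⟨by omega, Or.inr hprev⟩

theorem exists_mem_removableRows_of_covBy (h : κ ⋖ μ) :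
    ∃ i ∈ removableRows μ, κ.cells = μ.cells.erase (i, μ.rowLen i - 1) := by
  obtain ⟨⟨i, j⟩, hc, hμ⟩ := exists_cells_eq_insert h
  have mem_κ : ∀ x ∈ μ, x ≠ (i, j) → x ∈ κ := by
    intro x hx hne
    rw [← mem_cells, hμ, Finset.mem_insert, mem_cells] at hx
    exact hx.resolve_left hne
  have hij : (i, j) ∈ μ := by
    rw [← mem_cells, hμ]
    exact Finset.mem_insert_self _ _
  have hlt : j < μ.rowLen i := mem_iff_lt_rowLen.1 hij
  have hj : j = μ.rowLen i - 1 := by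
    by_contra hne
    exact hc (κ.up_left_mem le_rfl (Nat.le_succ j)
      (mem_κ (i, j + 1) (mem_iff_lt_rowLen.2 (by omega)) (by simp)))
  refine ⟨i, ?_, ?_⟩
  · simp only [removableRows, Finset.mem_filter, Finset.mem_range]
    refine ⟨mem_iff_lt_colLen.1 (μ.up_left_mem le_rfl (Nat.zero_le _) hij), ?_⟩
    by_contra hle
    exact hc (κ.up_left_mem (Nat.le_succ i) le_rfl
      (mem_κ (i + 1, j) (mem_iff_lt_rowLen.2 (by omega)) (by simp)))
  · rw [← hj, hμ, Finset.erase_insert (by simpa using hc)]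

theorem card_upperCovers_eq_card_addableRows (κ : YoungDiagram) :
    (upperCovers κ).card = (addableRows κ).card := by
  refine (Finset.card_bij (fun i hi => insertBox κ (i, κ.rowLen i)
    (mem_of_lt_of_mem_addableRows hi)) ?_ ?_ ?_).symm
  · intro i hi
    refine mem_upperCovers.2 (covBy_of_le_of_card_eq ?_ ?_)
    · exact cells_subset_iff.1 (Finset.subset_insert _ _)
    · exact Finset.card_insert_of_notMem (by simp [mem_iff_lt_rowLen])
  · intro i hi j hj hij
    have hcells : insert (i, κ.rowLen i) κ.cells = insert (j, κ.rowLen j) κ.cells :=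
      congrArg YoungDiagram.cells hij
    have hmem := Finset.mem_insert_self (i, κ.rowLen i) κ.cells
    rw [hcells, Finset.mem_insert] at hmem
    rcases hmem with heq | hκ
    · exact (Prod.mk.inj heq).1
    · simp [mem_iff_lt_rowLen] at hκ
  · intro μ hμ
    obtain ⟨i, hi, hcells⟩ := exists_mem_addableRows_of_covBy (mem_upperCovers.1 hμ)
    exact ⟨i, hi, YoungDiagram.ext hcells.symm⟩

theorem card_lowerCovers_eq_card_removableRows (μ : YoungDiagram) :
    (lowerCovers μ).card = (removableRows μ).card := by
  refine (Finset.card_bij (fun i hi => eraseBox μ (i, μ.rowLen i - 1)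
    (eq_of_le_of_mem_removableRows hi)) ?_ ?_ ?_).symm
  · intro i hi
    refine mem_lowerCovers.2 (covBy_of_le_of_card_eq ?_ ?_)
    · exact cells_subset_iff.1 (Finset.erase_subset _ _)
    · exact (Finset.card_erase_add_one (rowEnd_mem_of_mem_removableRows hi)).symm
  · intro i hi j hj hij
    by_contra hne
    have hmem : (i, μ.rowLen i - 1) ∈ μ.cells.erase (j, μ.rowLen j - 1) :=
      Finset.mem_erase.2 ⟨fun h => hne (Prod.mk.inj h).1, rowEnd_mem_of_mem_removableRows hi⟩
    have hcells : μ.cells.erase (i, μ.rowLen i - 1) = μ.cells.erase (j, μ.rowLen j - 1) :=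
      congrArg YoungDiagram.cells hij
    rw [← hcells] at hmem
    exact Finset.notMem_erase _ _ hmem
  · intro κ hκ
    obtain ⟨i, hi, hcells⟩ := exists_mem_removableRows_of_covBy (mem_lowerCovers.1 hκ)
    exact ⟨i, hi, YoungDiagram.ext hcells.symm⟩

theorem card_upperCovers (κ : YoungDiagram) :
    (upperCovers κ).card = (lowerCovers κ).card + 1 := by
  rw [card_upperCovers_eq_card_addableRows, card_lowerCovers_eq_card_removableRows,
    card_addableRows]

theorem youngCard_eq_zero_iff : κ.card = 0 ↔ κ = ⊥ := by
  rw [YoungDiagram.card, Finset.card_eq_zero, ← YoungDiagram.cells_bot, YoungDiagram.ext_iff]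

theorem card_youngIndex_bot : Fintype.card (YoungIndex ⊥) = 1 := by
  rw [Fintype.card_eq_one_iff]
  refine ⟨YoungPath.nil, fun p => ?_⟩
  cases p with
  | nil => rfl
  | cons p h => exact absurd h.lt not_lt_bot

theorem card_youngIndex_eq_sum (hμ : μ ≠ ⊥) :
    Fintype.card (YoungIndex μ) = ∑ κ ∈ lowerCovers μ, Fintype.card (YoungIndex κ) := by
  classical
  rw [← Finset.sum_coe_sort, ← Fintype.card_sigma]
  refine (Fintype.card_congr (Equiv.ofBijective
    (fun x => YoungPath.cons x.2 (mem_lowerCovers.1 x.1.2)) ⟨?_, ?_⟩)).symm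
  · rintro ⟨⟨κ, hκ⟩, p⟩ ⟨⟨κ', hκ'⟩, p'⟩ h
    cases h
    rfl
  · intro p
    cases p with
    | nil => exact absurd rfl hμ
    | cons p h => exact ⟨⟨⟨_, mem_lowerCovers.2 h⟩, p⟩, rfl⟩

-- Young's lattice is differential: `DU - UD = 1`. As `D f = f` for the path count `f`, induction
-- along `U f = (n + 1) f` works.
theorem sum_upperCovers_card_youngIndex (n : ℕ) (κ : YoungDiagram) (hκ : κ.card = n) :
    ∑ μ ∈ upperCovers κ, Fintype.card (YoungIndex μ) = (n + 1) * Fintype.card (YoungIndex κ) := by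
  classical
  induction n using Nat.strong_induction_on generalizing κ with
  | _ n ih =>
  set f := fun μ : YoungDiagram => Fintype.card (YoungIndex μ) with hf
  have hup : ∀ μ ∈ upperCovers κ, f μ = f κ + ∑ ρ ∈ (lowerCovers μ).erase κ, f ρ := by
    intro μ hμ
    rw [mem_upperCovers] at hμ
    rw [Finset.add_sum_erase _ f (mem_lowerCovers.2 hμ)]
    exact card_youngIndex_eq_sum (bot_le.trans_lt hμ.lt).ne'
  have hdown : ∀ τ ∈ lowerCovers κ, n * f τ = f κ + ∑ ρ ∈ (upperCovers τ).erase κ, f ρ := by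
    intro τ hτ
    rw [mem_lowerCovers] at hτ
    have hcard := card_eq_of_covBy hτ
    rw [Finset.add_sum_erase _ f (mem_upperCovers.2 hτ), ih τ.card (by omega) τ rfl, ← hκ, hcard]
  have hcomm := sum_upper_lower_covers_comm (fun _ _ => mem_upperCovers)
    (fun _ _ => mem_lowerCovers) f κ
  have hlower : n * ∑ τ ∈ lowerCovers κ, f τ = n * f κ := by
    rcases eq_or_ne κ ⊥ with hbot | hne
    · rw [← hκ, youngCard_eq_zero_iff.2 hbot, zero_mul, zero_mul]
    · rw [hf, ← card_youngIndex_eq_sum hne]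
  have hup_sum := Finset.sum_congr rfl hup
  have hdown_sum := Finset.sum_congr rfl hdown
  rw [Finset.sum_add_distrib, Finset.sum_const, smul_eq_mul] at hup_sum hdown_sum
  rw [← Finset.mul_sum, hlower] at hdown_sum
  rw [hup_sum, hcomm, card_upperCovers, add_mul, add_mul, hdown_sum]
  ring

theorem sum_card_youngIndex_sq (n : ℕ) :
    ∑ μ ∈ youngDiagrams n n, Fintype.card (YoungIndex μ) ^ 2 = n.factorial := by
  induction n with
  | zero =>
    have hbot : youngDiagrams 0 0 = {⊥} := by
      ext μ
      rw [mem_youngDiagrams_self, Finset.mem_singleton, youngCard_eq_zero_iff]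
    simp [hbot, card_youngIndex_bot]
  | succ n ih =>
    have hdown : ∀ μ ∈ youngDiagrams (n + 1) (n + 1), Fintype.card (YoungIndex μ) ^ 2 =
        ∑ κ ∈ lowerCovers μ, Fintype.card (YoungIndex μ) * Fintype.card (YoungIndex κ) := by
      intro μ hμ
      have hne : μ ≠ ⊥ := fun hbot => by
        rw [mem_youngDiagrams_self, youngCard_eq_zero_iff.2 hbot] at hμ
        omega
      rw [← Finset.mul_sum, ← card_youngIndex_eq_sum hne, sq]
    have hup : ∀ κ ∈ youngDiagrams n n,
        ∑ μ ∈ upperCovers κ, Fintype.card (YoungIndex μ) * Fintype.card (YoungIndex κ) =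
        (n + 1) * Fintype.card (YoungIndex κ) ^ 2 := by
      intro κ hκ
      rw [← Finset.sum_mul,
        sum_upperCovers_card_youngIndex n κ (mem_youngDiagrams_self.1 hκ), mul_assoc, sq]
    have hswap : ∀ μ κ, μ ∈ youngDiagrams (n + 1) (n + 1) ∧ κ ∈ lowerCovers μ ↔
        μ ∈ upperCovers κ ∧ κ ∈ youngDiagrams n n := by
      intro μ κ
      simp only [mem_youngDiagrams_self, mem_lowerCovers, mem_upperCovers]
      rw [and_comm]
      refine and_congr_right fun hcov => ?_
      have := card_eq_of_covBy hcov
      omega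
    rw [Finset.sum_congr rfl hdown, Finset.sum_comm' hswap, Finset.sum_congr rfl hup,
      ← Finset.mul_sum, ih, Nat.factorial_succ]

end YoungLattice

section Paths

namespace YoungPath

variable {α β μ : YoungDiagram}

theorem le (p : YoungPath α μ) : α ≤ μ := by
  induction p with
  | nil => exact le_rfl
  | cons _ h ih => exact ih.trans h.le

theorem card_le_card (p : YoungPath α μ) : α.card ≤ μ.card :=
  Finset.card_le_card (YoungDiagram.cells_subset_iff.2 p.le)

theorem exists_eq_comp (q : YoungPath α μ) {M : ℕ} (hα : α.card ≤ M) (hμ : M ≤ μ.card) :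
    ∃ (β : YoungDiagram) (a : YoungPath α β) (r : YoungPath β μ), β.card = M ∧ q = a.comp r := by
  induction q with
  | nil => exact ⟨α, nil, nil, by omega, rfl⟩
  | @cons κ μ p h ih =>
    rcases Nat.lt_or_ge κ.card M with hlt | hle
    · have := card_eq_of_covBy h
      exact ⟨μ, cons p h, nil, by omega, rfl⟩
    · obtain ⟨β, a, r, hβ, rfl⟩ := ih hle
      exact ⟨β, a, cons r h, hβ, rfl⟩

theorem comp_left_injective (r : YoungPath β μ) :
    Function.Injective fun a : YoungPath α β => a.comp r := by
  induction r with
  | nil => exact fun a b h => h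
  | cons r h ih =>
    intro a b hab
    exact ih (by simpa [comp] using hab)

theorem comp_right_injective (a : YoungPath α β) :
    Function.Injective fun r : YoungPath β μ => a.comp r := by
  intro r s hrs
  induction r with
  | nil =>
    cases s with
    | nil => rfl
    | cons s h => exact absurd s.card_le_card (by have := card_eq_of_covBy h; omega)
  | cons r h ih =>
    cases s with
    | nil => exact absurd r.card_le_card (by have := card_eq_of_covBy h; omega)
    | cons s h' =>
      simp only [comp] at hrs
      injection hrs with hκ _ hcomp
      subst hκ
      rw [ih (eq_of_heq hcomp)]

end YoungPath

end Paths

section ViaEmbedding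

theorem viaEmbedding_trans {α β γ : Type*} (σ : Perm α) (f : α ↪ β) (g : β ↪ γ) :
    σ.viaEmbedding (f.trans g) = (σ.viaEmbedding f).viaEmbedding g := by
  ext c
  by_cases hg : c ∈ Set.range g
  · obtain ⟨b, rfl⟩ := hg
    rw [Perm.viaEmbedding_apply]
    by_cases hf : b ∈ Set.range f
    · obtain ⟨a, rfl⟩ := hf
      rw [Perm.viaEmbedding_apply]
      exact Perm.viaEmbedding_apply σ (f.trans g) a
    · rw [Perm.viaEmbedding_apply_of_notMem σ f b hf, Perm.viaEmbedding_apply_of_notMem]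
      rintro ⟨a, ha⟩
      exact hf ⟨a, g.injective ha⟩
  · rw [Perm.viaEmbedding_apply_of_notMem _ g c hg, Perm.viaEmbedding_apply_of_notMem]
    rintro ⟨a, rfl⟩
    exact hg ⟨f a, rfl⟩

theorem viaEmbedding_castAddEmb_castAdd {n k : ℕ} (σ : Perm (Fin n)) (i : Fin n) :
    σ.viaEmbedding (Fin.castAddEmb k) (Fin.castAdd k i) = Fin.castAdd k (σ i) :=
  Perm.viaEmbedding_apply σ (Fin.castAddEmb k) i

theorem viaEmbedding_castAddEmb_natAdd {n k : ℕ} (σ : Perm (Fin n)) (j : Fin k) :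
    σ.viaEmbedding (Fin.castAddEmb k) (Fin.natAdd n j) = Fin.natAdd n j := by
  apply Perm.viaEmbedding_apply_of_notMem
  rintro ⟨i, hi⟩
  have hval : i.val = n + j.val := congrArg Fin.val hi
  omega

theorem viaEmbedding_castAddEmb_zero {n : ℕ} (σ : Perm (Fin n)) :
    σ.viaEmbedding (Fin.castAddEmb 0) = σ := by
  ext i
  exact congrArg Fin.val (viaEmbedding_castAddEmb_castAdd (k := 0) σ i)

theorem viaEmbedding_castAddEmb_succ {n k : ℕ} (σ : Perm (Fin n)) :
    σ.viaEmbedding (Fin.castAddEmb (k + 1)) =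
      (σ.viaEmbedding (Fin.castAddEmb k)).viaEmbedding (Fin.castSuccEmb : Fin (n + k) ↪ _) :=
  viaEmbedding_trans σ (Fin.castAddEmb k) Fin.castSuccEmb

end ViaEmbedding

section PRIR

variable {N : ℕ} {φ : MatrixFamily}

theorem IsPRIR.restrict_comp (hφ : IsPRIR N φ) {M : ℕ} {α : YoungDiagram} (hα : α.card = M)
    (σ : Perm (Fin M)) (a b : YoungIndex α) : ∀ (k : ℕ) {μ : YoungDiagram} (r : YoungPath α μ),
    M + k ≤ N → μ.card = M + k →
    (φ (M + k) μ (σ.viaEmbedding (Fin.castAddEmb k))).1 (a.comp r) (b.comp r) = (φ M α σ).1 a b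
  | 0, μ, r, _, hμ => by
    cases r with
    | nil => rw [viaEmbedding_castAddEmb_zero]; rfl
    | cons r h => exact absurd r.card_le_card (by have := card_eq_of_covBy h; omega)
  | k + 1, μ, r, hN, hμ => by
    cases r with
    | nil => omega
    | cons r h =>
      have := card_eq_of_covBy h
      rw [viaEmbedding_castAddEmb_succ]
      exact (hφ.restrict_same (M + k) _ _ h hN hμ _ _ _).trans
        (hφ.restrict_comp hα σ a b k r (by omega) (by omega))

theorem IsPRIR.restrict_comp_of_ne (hφ : IsPRIR N φ) {M : ℕ} {α : YoungDiagram} (hα : α.card = M)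
    (σ : Perm (Fin M)) (a : YoungIndex α) : ∀ (k : ℕ) {μ : YoungDiagram} (r : YoungPath α μ)
    (q : YoungIndex μ), (∀ c : YoungIndex α, c.comp r ≠ q) → M + k ≤ N → μ.card = M + k →
    (φ (M + k) μ (σ.viaEmbedding (Fin.castAddEmb k))).1 (a.comp r) q = 0
  | 0, μ, r, q, hq, _, hμ => by
    cases r with
    | nil => exact absurd rfl (hq q)
    | cons r h => exact absurd r.card_le_card (by have := card_eq_of_covBy h; omega)
  | k + 1, μ, r, q, hq, hN, hμ => by
    cases r with
    | nil => omega
    | @cons κ _ r h =>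
      have := card_eq_of_covBy h
      rw [viaEmbedding_castAddEmb_succ]
      cases q with
      | nil => exact absurd h.lt not_lt_bot
      | @cons κ' _ q h' =>
        rcases eq_or_ne κ κ' with rfl | hne
        · refine (hφ.restrict_same (M + k) _ _ h hN hμ _ _ _).trans
            (hφ.restrict_comp_of_ne hα σ a k r q ?_ (by omega) (by omega))
          rintro c rfl
          exact hq c rfl
        · exact hφ.restrict_ne (M + k) _ _ _ h h' hne hN hμ _ _ _

theorem IsPRIR.isIrreducible (hφ : IsPRIR N φ) {m : ℕ} (hm : m ≤ N) {μ : YoungDiagram}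
    (hμ : μ.card = m) : (matrixRep (φ m μ)).IsIrreducible :=
  (hφ.irrep m μ hm hμ).1

theorem IsPRIR.isEmpty_equiv (hφ : IsPRIR N φ) {m : ℕ} (hm : m ≤ N) {μ ν : YoungDiagram}
    (hμ : μ.card = m) (hν : ν.card = m) (hne : μ ≠ ν) :
    IsEmpty (Representation.Equiv (matrixRep (φ m μ)) (matrixRep (φ m ν))) :=
  (hφ.irrep m μ hm hμ).isEmpty_equiv (hφ.irrep m ν hm hν) hne

-- The matrix units are linearly independent, and there are `∑ f_μ ^ 2 = m!` of them.
theorem IsPRIR.span_matrixUnit (hφ : IsPRIR N φ) {m : ℕ} (hm : m ≤ N) :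
    Submodule.span ℂ {x | ∃ μ ∈ youngDiagrams m m, ∃ i j, x = matrixUnit (φ m μ) i j} = ⊤ := by
  have hcard : ∀ μ : youngDiagrams m m, μ.1.card = m := fun μ => mem_youngDiagrams_self.1 μ.2
  have hli := linearIndependent_matrixUnit (ρ := fun μ : youngDiagrams m m => φ m μ.1)
    (fun μ => hφ.isIrreducible hm (hcard μ))
    (fun μ ν hne => hφ.isEmpty_equiv hm (hcard μ) (hcard ν) fun h => hne (Subtype.ext h))
  have hdim : Fintype.card (Σ μ : youngDiagrams m m, YoungIndex μ.1 × YoungIndex μ.1) =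
      Module.finrank ℂ (MonoidAlgebra ℂ (Perm (Fin m))) := by
    rw [Fintype.card_sigma]
    simp only [Fintype.card_prod, ← sq]
    rw [Finset.sum_coe_sort (youngDiagrams m m) fun μ => Fintype.card (YoungIndex μ) ^ 2,
      sum_card_youngIndex_sq, (MonoidAlgebra.coeffLinearEquiv ℂ).finrank_eq]
    simp [Fintype.card_perm]
  rw [eq_top_iff, ← hli.span_eq_top_of_card_eq_finrank' hdim, Submodule.span_le]
  rintro _ ⟨⟨μ, i, j⟩, rfl⟩
  exact Submodule.subset_span ⟨μ.1, μ.2, i, j, rfl⟩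

end PRIR

/-! ### Partial traces of permutation operators -/

section Append

variable {α : Type*} {m n : ℕ}

theorem sum_finAppend {M : Type*} [AddCommMonoid M] [Fintype α] (f : (Fin (m + n) → α) → M) :
    ∑ x, f x = ∑ a : Fin m → α, ∑ b : Fin n → α, f (Fin.append a b) := by
  rw [← Fintype.sum_prod_type', ← (Fin.appendEquiv m n).sum_comp]
  rfl

theorem exists_eq_finAppend (x : Fin (m + n) → α) :
    ∃ (a : Fin m → α) (b : Fin n → α), x = Fin.append a b :=
  ⟨_, _, (Fin.append_castAdd_natAdd (f := x)).symm⟩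

theorem finAppend_inj {a c : Fin m → α} {b e : Fin n → α} :
    Fin.append a b = Fin.append c e ↔ a = c ∧ b = e :=
  (Fin.appendEquiv m n).injective.eq_iff (a := (a, b)) (b := (c, e)) |>.trans Prod.mk_inj

end Append

theorem exists_eq_viaEmbedding {α β : Type*} (f : α ↪ β) (σ : Perm β)
    (hσ : ∀ b ∉ Set.range f, σ b = b) : ∃ τ : Perm α, σ = τ.viaEmbedding f := by
  have hmem : ∀ b, σ b ∈ Set.range f ↔ b ∈ Set.range f := by
    intro b
    by_cases hb : b ∈ Set.range f
    · refine iff_of_true ?_ hb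
      by_contra hσb
      rw [σ.injective (hσ _ hσb)] at hσb
      exact hσb hb
    · rw [hσ b hb]
  refine ⟨(Equiv.ofInjective f f.injective).symm.permCongr (σ.subtypePerm hmem), ?_⟩
  ext b
  by_cases hb : b ∈ Set.range f
  · obtain ⟨a, rfl⟩ := hb
    rw [Perm.viaEmbedding_apply, permCongr_apply, symm_symm]
    exact (apply_ofInjective_symm f.injective
      (σ.subtypePerm hmem (ofInjective f f.injective a))).symm
  · rw [Perm.viaEmbedding_apply_of_notMem _ f b hb, hσ b hb]

section PermOp

variable {n d : ℕ}

theorem TensorOp.ext_append {m n : ℕ} {A B : TensorOp (m + n) d}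
    (h : ∀ a b c e, A (Fin.append a b) (Fin.append c e) = B (Fin.append a b) (Fin.append c e)) :
    A = B := by
  ext x y
  obtain ⟨a, b, rfl⟩ := exists_eq_finAppend x
  obtain ⟨c, e, rfl⟩ := exists_eq_finAppend y
  exact h a b c e

theorem permOp_apply (σ : Perm (Fin n)) (y x : Fin n → Fin d) :
    permOp n d σ y x = if y = fun i => x (σ⁻¹ i) then 1 else 0 := rfl

theorem mul_permOp_apply {ι : Type*} (A : Matrix ι (Fin n → Fin d) ℂ) (σ : Perm (Fin n))
    (x : ι) (y : Fin n → Fin d) : (A * permOp n d σ) x y = A x fun i => y (σ⁻¹ i) := by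
  simp [Matrix.mul_apply, permOp_apply]

theorem permOp_mul (σ τ : Perm (Fin n)) :
    permOp n d (σ * τ) = permOp n d σ * permOp n d τ := by
  ext x y
  simp [mul_permOp_apply, permOp_apply]

theorem permOp_one : permOp n d 1 = 1 := by
  ext x y
  simp [permOp_apply, Matrix.one_apply]

theorem permOp_conjTranspose (σ : Perm (Fin n)) :
    (permOp n d σ).conjTranspose = permOp n d σ⁻¹ := by
  ext x y
  have hiff : (y = fun i => x (σ⁻¹ i)) ↔ (x = fun i => y (σ⁻¹⁻¹ i)) := by
    rw [inv_inv]
    exact ((Equiv.arrowCongr σ (Equiv.refl (Fin d))).symm_apply_eq (x := y) (y := x)).symm.trans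
      eq_comm
  rw [Matrix.conjTranspose_apply, permOp_apply, permOp_apply, if_congr hiff rfl rfl]
  split_ifs <;> simp

/-- The action of the group algebra of the symmetric group on the tensor power. -/
noncomputable def permAlgHom (n d : ℕ) : MonoidAlgebra ℂ (Perm (Fin n)) →ₐ[ℂ] TensorOp n d :=
  MonoidAlgebra.lift ℂ _ _ ⟨⟨permOp n d, permOp_one⟩, permOp_mul⟩

theorem permAlgHom_single (σ : Perm (Fin n)) (c : ℂ) :
    permAlgHom n d (MonoidAlgebra.single σ c) = c • permOp n d σ := by
  simp [permAlgHom]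

theorem permOp_mem_range (σ : Perm (Fin n)) : permOp n d σ ∈ (permAlgHom n d).range :=
  ⟨MonoidAlgebra.single σ 1, (permAlgHom_single σ 1).trans (one_smul ℂ _)⟩

theorem permAlgHom_range_le_of_permOp_mem (S : Submodule ℂ (TensorOp n d))
    (h : ∀ σ, permOp n d σ ∈ S) : Subalgebra.toSubmodule (permAlgHom n d).range ≤ S := by
  rintro _ ⟨x, rfl⟩
  change permAlgHom n d x ∈ S
  induction x using MonoidAlgebra.induction_on with
  | of σ => simpa [permAlgHom_single] using h σ
  | add x y hx hy => rw [map_add]; exact S.add_mem hx hy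
  | smul c x hx => rw [map_smul]; exact S.smul_mem c hx

end PermOp

section ExtendOp

open scoped Kronecker

variable {n k d : ℕ}

/-- The operator `A ⊗ 1` on `n + k` systems. -/
noncomputable def extendOp (n k d : ℕ) : TensorOp n d →ₐ[ℂ] TensorOp (n + k) d :=
  (Matrix.reindexAlgEquiv ℂ ℂ (Fin.appendEquiv n k)).toAlgHom.comp
    (AlgHom.ofLinearMap
      { toFun := fun A => A ⊗ₖ (1 : TensorOp k d)
        map_add' := fun A B => Matrix.add_kronecker A B 1
        map_smul' := fun c A => Matrix.smul_kronecker c A 1 }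
      Matrix.one_kronecker_one fun A B => by
        simpa using Matrix.mul_kronecker_mul A B (1 : TensorOp k d) 1)

theorem extendOp_append (A : TensorOp n d) (a c : Fin n → Fin d) (b e : Fin k → Fin d) :
    extendOp n k d A (Fin.append a b) (Fin.append c e) = if b = e then A a c else 0 := by
  simp [extendOp, Fin.appendEquiv, Matrix.one_apply]

theorem extendOp_conjTranspose (A : TensorOp n d) :
    extendOp n k d A.conjTranspose = (extendOp n k d A).conjTranspose := by
  apply TensorOp.ext_append
  intro a b c e
  rw [Matrix.conjTranspose_apply, extendOp_append, extendOp_append, Matrix.conjTranspose_apply]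
  by_cases h : b = e
  · simp [h]
  · simp [h, Ne.symm h]

theorem append_comp_viaEmbedding {α : Type*} (σ : Perm (Fin n)) (c : Fin n → α) (e : Fin k → α) :
    (fun i => Fin.append c e (σ.viaEmbedding (Fin.castAddEmb k) i)) =
      Fin.append (fun i => c (σ i)) e := by
  ext1 i
  refine Fin.addCases (fun i => ?_) (fun j => ?_) i
  · rw [viaEmbedding_castAddEmb_castAdd, Fin.append_left, Fin.append_left]
  · rw [viaEmbedding_castAddEmb_natAdd, Fin.append_right, Fin.append_right]

theorem extendOp_permOp (σ : Perm (Fin n)) :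
    extendOp n k d (permOp n d σ) = permOp (n + k) d (σ.viaEmbedding (Fin.castAddEmb k)) := by
  apply TensorOp.ext_append
  intro a b c e
  have hinv : (σ.viaEmbedding (Fin.castAddEmb k))⁻¹ = σ⁻¹.viaEmbedding (Fin.castAddEmb k) :=
    (map_inv (Perm.viaEmbeddingHom (Fin.castAddEmb k)) σ).symm
  rw [extendOp_append, permOp_apply, permOp_apply, hinv, append_comp_viaEmbedding]
  simp only [finAppend_inj, and_comm (a := a = _), ite_and]

theorem extendOp_mem_range {X : TensorOp n d} (hX : X ∈ (permAlgHom n d).range) :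
    extendOp n k d X ∈ (permAlgHom (n + k) d).range := by
  refine permAlgHom_range_le_of_permOp_mem ((Subalgebra.toSubmodule
    (permAlgHom (n + k) d).range).comap (extendOp n k d).toLinearMap) (fun σ => ?_) hX
  change extendOp n k d (permOp n d σ) ∈ (permAlgHom (n + k) d).range
  rw [extendOp_permOp]
  exact permOp_mem_range _

end ExtendOp

section PartialTrace

variable {n k d : ℕ}

/-- The partial trace over the last `k` of `n + k` systems. -/
def partialTrace (n k d : ℕ) : TensorOp (n + k) d →ₗ[ℂ] TensorOp n d where
  toFun X := Matrix.of fun a c => ∑ e : Fin k → Fin d, X (Fin.append a e) (Fin.append c e)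
  map_add' X Y := by
    ext a c
    simp [Finset.sum_add_distrib]
  map_smul' r X := by
    ext a c
    simp [Finset.mul_sum]

theorem partialTrace_apply (X : TensorOp (n + k) d) (a c : Fin n → Fin d) :
    partialTrace n k d X a c = ∑ e : Fin k → Fin d, X (Fin.append a e) (Fin.append c e) := rfl

theorem partialTrace_extendOp_mul (A : TensorOp n d) (X : TensorOp (n + k) d) :
    partialTrace n k d (extendOp n k d A * X) = A * partialTrace n k d X := by
  ext a c
  simp only [partialTrace_apply, Matrix.mul_apply, sum_finAppend, extendOp_append, ite_mul,
    zero_mul, Finset.sum_ite_eq, Finset.mem_univ, if_true, Finset.mul_sum]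
  rw [Finset.sum_comm]

theorem partialTrace_mul_extendOp (A : TensorOp n d) (X : TensorOp (n + k) d) :
    partialTrace n k d (X * extendOp n k d A) = partialTrace n k d X * A := by
  ext a c
  simp only [partialTrace_apply, Matrix.mul_apply, sum_finAppend, extendOp_append, mul_ite,
    mul_zero, Finset.sum_ite_eq', Finset.mem_univ, if_true, Finset.sum_mul]
  rw [Finset.sum_comm]

theorem trace_partialTrace (X : TensorOp (n + k) d) :
    (partialTrace n k d X).trace = X.trace := by
  simp [Matrix.trace, partialTrace_apply, sum_finAppend]

theorem partialTrace_zero (X : TensorOp (n + 0) d) : partialTrace n 0 d X = X := by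
  ext a c
  rw [partialTrace_apply, Fintype.sum_unique, Fin.append_right_nil _ _ rfl,
    Fin.append_right_nil _ _ rfl]
  rfl

theorem partialTrace_succ (X : TensorOp (n + (k + 1)) d) :
    partialTrace n (k + 1) d X = partialTrace n k d (partialTrace (n + k) 1 d X) := by
  ext a c
  simp only [partialTrace_apply]
  rw [sum_finAppend (m := k) (n := 1)]
  refine Finset.sum_congr rfl fun e _ => Finset.sum_congr rfl fun f _ => ?_
  rw [Fin.append_assoc, Fin.append_assoc]
  rfl

theorem append_comp_swap {α : Type*} (c : Fin n → α) (e : Fin 1 → α) (j : Fin n) :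
    (fun i => Fin.append c e (swap j.castSucc (Fin.last n) i)) =
      Fin.append (Function.update c j (e 0)) fun _ => c j := by
  ext1 i
  induction i using Fin.lastCases with
  | last =>
    rw [swap_apply_right]
    exact (Fin.append_left c e j).trans (Fin.append_right (Function.update c j (e 0))
      (fun _ => c j) 0).symm
  | cast i =>
    refine Eq.trans ?_ (Fin.append_left (Function.update c j (e 0)) _ i).symm
    rcases eq_or_ne i j with rfl | hij
    · rw [swap_apply_left, Function.update_self]
      exact Fin.append_right c e 0
    · rw [swap_apply_of_ne_of_ne ((Fin.castSucc_injective n).ne hij) (Fin.castSucc_ne_last i),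
        Function.update_of_ne hij]
      exact Fin.append_left c e i

theorem partialTrace_one_swap (j : Fin n) :
    partialTrace n 1 d (permOp (n + 1) d (swap j.castSucc (Fin.last n))) = 1 := by
  ext a c
  have hiff : ∀ e : Fin 1 → Fin d,
      (a = Function.update c j (e 0) ∧ e = fun _ => c j) ↔ e = (fun _ => c j) ∧ a = c := by
    intro e
    rw [and_comm]
    refine and_congr_right ?_
    rintro rfl
    rw [Function.update_eq_self]
  simp only [partialTrace_apply, permOp_apply, swap_inv, append_comp_swap, finAppend_inj, hiff,
    Matrix.one_apply, ite_and, Finset.sum_ite_eq', Finset.mem_univ, if_true]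

theorem partialTrace_one_one : partialTrace n 1 d 1 = (d : ℂ) • 1 := by
  ext a c
  simp only [partialTrace_apply, Matrix.one_apply, finAppend_inj, and_true, Matrix.smul_apply]
  split_ifs <;> simp

theorem partialTrace_one_mem_range {X : TensorOp (n + 1) d}
    (hX : X ∈ (permAlgHom (n + 1) d).range) :
    partialTrace n 1 d X ∈ (permAlgHom n d).range := by
  refine permAlgHom_range_le_of_permOp_mem
    ((Subalgebra.toSubmodule (permAlgHom n d).range).comap (partialTrace n 1 d)) (fun σ => ?_) hX
  rw [Submodule.mem_comap, Subalgebra.mem_toSubmodule]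
  have exists_eq_extendOp : ∀ σ : Perm (Fin (n + 1)), σ (Fin.last n) = Fin.last n →
      ∃ τ, permOp (n + 1) d σ = extendOp n 1 d (permOp n d τ) := by
    intro σ hσ
    obtain ⟨τ, rfl⟩ := exists_eq_viaEmbedding (Fin.castAddEmb 1) σ fun i hi =>
      Fin.lastCases (fun _ => hσ) (fun i hi => absurd ⟨i, rfl⟩ hi) i hi
    exact ⟨τ, (extendOp_permOp τ).symm⟩
  induction hlast : σ (Fin.last n) using Fin.lastCases with
  | last =>
    obtain ⟨τ, hτ⟩ := exists_eq_extendOp σ hlast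
    rw [hτ, ← mul_one (extendOp n 1 d _), partialTrace_extendOp_mul, partialTrace_one_one,
      mul_smul_comm, mul_one]
    exact Subalgebra.smul_mem _ (permOp_mem_range τ) _
  | cast j =>
    obtain ⟨τ, hτ⟩ := exists_eq_extendOp (swap j.castSucc (Fin.last n) * σ)
      (by rw [Perm.mul_apply, hlast, swap_apply_left])
    have hσ : permOp (n + 1) d σ = permOp (n + 1) d (swap j.castSucc (Fin.last n)) *
        extendOp n 1 d (permOp n d τ) := by
      rw [← hτ, ← permOp_mul, ← mul_assoc, swap_mul_self, one_mul]
    rw [hσ, partialTrace_mul_extendOp, partialTrace_one_swap, one_mul]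
    exact permOp_mem_range τ

theorem partialTrace_mem_range : ∀ {k : ℕ} {X : TensorOp (n + k) d},
    X ∈ (permAlgHom (n + k) d).range → partialTrace n k d X ∈ (permAlgHom n d).range
  | 0, X, hX => by rwa [partialTrace_zero]
  | k + 1, X, hX => by
    rw [partialTrace_succ]
    exact partialTrace_mem_range (partialTrace_one_mem_range hX)

end PartialTrace

/-! ### Partial transposition and maximally entangled pairs -/

section PairInsertion

variable {M k d : ℕ} {ι : Type*}

/-- The isometry, up to normalization, that tensors a vector on `M` systems with `k` maximally
entangled pairs; as in `V^{(k)}`, the pairs consist of the systems `M + j` and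
`M + 2 k - 1 - j`. -/
def pairInsertion (M k d : ℕ) : Matrix (Fin (M + k + k) → Fin d) (Fin M → Fin d) ℂ :=
  Matrix.of fun x z => if (fun i => x (Fin.castAdd k i)) =
    Fin.append z (fun j => x (Fin.natAdd (M + k) (Fin.rev j))) then 1 else 0

theorem pairInsertion_append (a : Fin (M + k) → Fin d) (b : Fin k → Fin d) (z : Fin M → Fin d) :
    pairInsertion M k d (Fin.append a b) z =
      if a = Fin.append z (fun j => b (Fin.rev j)) then 1 else 0 := by
  simp [pairInsertion]

theorem mul_pairInsertion_apply (A : Matrix ι (Fin (M + k + k) → Fin d) ℂ) (x : ι)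
    (z : Fin M → Fin d) :
    (A * pairInsertion M k d) x z =
      ∑ b : Fin k → Fin d, A x (Fin.append (Fin.append z fun j => b (Fin.rev j)) b) := by
  rw [Matrix.mul_apply, sum_finAppend, Finset.sum_comm]
  simp [pairInsertion_append]

theorem pairInsertion_conjTranspose_mul_apply (A : Matrix (Fin (M + k + k) → Fin d) ι ℂ)
    (z : Fin M → Fin d) (x : ι) :
    ((pairInsertion M k d).conjTranspose * A) z x =
      ∑ b : Fin k → Fin d, A (Fin.append (Fin.append z fun j => b (Fin.rev j)) b) x := by
  rw [Matrix.mul_apply, sum_finAppend, Finset.sum_comm]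
  simp [pairInsertion_append, apply_ite (star : ℂ → ℂ)]

theorem pairInsertion_conjTranspose_mul_extendOp_mul (X : TensorOp (M + k) d) :
    (pairInsertion M k d).conjTranspose * extendOp (M + k) k d X * pairInsertion M k d =
      partialTrace M k d X := by
  ext z w
  rw [mul_pairInsertion_apply]
  simp only [pairInsertion_conjTranspose_mul_apply, extendOp_append]
  rw [Finset.sum_comm]
  simp only [Finset.sum_ite_eq, Finset.mem_univ, if_true, partialTrace_apply]
  exact (Equiv.arrowCongr Fin.revPerm (Equiv.refl (Fin d))).sum_comp
    (fun e => X (Fin.append z e) (Fin.append w e))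

theorem extendOp_extendOp_mul_pairInsertion (Y : TensorOp M d) :
    extendOp (M + k) k d (extendOp M k d Y) * pairInsertion M k d = pairInsertion M k d * Y := by
  ext x z
  obtain ⟨a, b, rfl⟩ := exists_eq_finAppend x
  obtain ⟨u, f, rfl⟩ := exists_eq_finAppend a
  rw [mul_pairInsertion_apply, Matrix.mul_apply]
  simp only [extendOp_append, pairInsertion_append, finAppend_inj, Finset.sum_ite_eq,
    Finset.mem_univ, if_true]
  by_cases h : f = fun j => b (Fin.rev j) <;> simp [h]

end PairInsertion

section PartialTranspose

variable {n k d : ℕ}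

theorem update_finAppend_natAdd {α : Type*} (a : Fin n → α) (b : Fin k → α) (j : Fin k) (v : α) :
    Function.update (Fin.append a b) (Fin.natAdd n j) v =
      Fin.append a (Function.update b j v) := by
  ext1 i
  refine Fin.addCases (fun i => ?_) (fun i => ?_) i
  · rw [Function.update_of_ne (by simp [Fin.ext_iff]; omega), Fin.append_left, Fin.append_left]
  · rw [Fin.append_right]
    rcases eq_or_ne i j with rfl | hij
    · simp
    · rw [Function.update_of_ne hij, Function.update_of_ne ((Fin.natAdd_injective k n).ne hij),
        Fin.append_right]

theorem partialTranspose_append (A : TensorOp (n + k) d) (j : Fin k)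
    (a c : Fin n → Fin d) (b e : Fin k → Fin d) :
    partialTranspose (Fin.natAdd n j) A (Fin.append a b) (Fin.append c e) =
      A (Fin.append a (Function.update b j (e j))) (Fin.append c (Function.update e j (b j))) := by
  simp only [partialTranspose, Matrix.of_apply, Fin.append_right, update_finAppend_natAdd]

theorem foldr_partialTranspose_append (A : TensorOp (n + k) d) (a c : Fin n → Fin d) :
    ∀ {l : List (Fin k)}, l.Nodup → ∀ b e : Fin k → Fin d,
    l.foldr (fun j B => partialTranspose (Fin.natAdd n j) B) A (Fin.append a b) (Fin.append c e) =
      A (Fin.append a fun j => if j ∈ l then e j else b j)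
        (Fin.append c fun j => if j ∈ l then b j else e j)
  | [], _, b, e => by simp
  | j :: l, hl, b, e => by
    obtain ⟨hj, hl⟩ := List.nodup_cons.1 hl
    have update_eq (b e : Fin k → Fin d) :
        (fun i => if i ∈ l then Function.update e j (b j) i else Function.update b j (e j) i) =
          fun i => if i ∈ j :: l then e i else b i := by
      ext1 i
      rcases eq_or_ne i j with rfl | hij
      · simp [hj]
      · simp [hij]
    rw [List.foldr_cons, partialTranspose_append, foldr_partialTranspose_append A a c hl,
      update_eq b e, update_eq e b]

theorem partialTransposeLast_append (A : TensorOp (n + k) d) (a c : Fin n → Fin d)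
    (b e : Fin k → Fin d) :
    partialTransposeLast n k A (Fin.append a b) (Fin.append c e) =
      A (Fin.append a e) (Fin.append c b) := by
  simp [partialTransposeLast, foldr_partialTranspose_append A a c (List.nodup_finRange k)]

theorem partialTransposeLast_conjTranspose (A : TensorOp (n + k) d) :
    (partialTransposeLast n k A).conjTranspose = partialTransposeLast n k A.conjTranspose := by
  apply TensorOp.ext_append
  intro a b c e
  rw [Matrix.conjTranspose_apply, partialTransposeLast_append, partialTransposeLast_append,
    Matrix.conjTranspose_apply]

theorem partialTransposeLast_mul_extendOp (A : TensorOp (n + k) d) (X : TensorOp n d) :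
    partialTransposeLast n k (A * extendOp n k d X) =
      partialTransposeLast n k A * extendOp n k d X := by
  apply TensorOp.ext_append
  intro a b c e
  simp only [partialTransposeLast_append, Matrix.mul_apply, sum_finAppend, extendOp_append,
    mul_ite, mul_zero, Finset.sum_ite_eq', Finset.mem_univ, if_true]

theorem partialTransposeLast_extendOp (X : TensorOp n d) :
    partialTransposeLast n k (extendOp n k d X) = extendOp n k d X := by
  apply TensorOp.ext_append
  intro a b c e
  simp only [partialTransposeLast_append, extendOp_append, eq_comm]

end PartialTranspose

section PairSwap

variable {M k d : ℕ}

/-- The permutation exchanging the two systems `M + j` and `M + 2 k - 1 - j` of each of the `k`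
pairs. -/
def pairSwap (M k : ℕ) : Perm (Fin (M + k + k)) :=
  Function.Involutive.toPerm
    (Fin.addCases (Fin.addCases (fun i => Fin.castAdd k (Fin.castAdd k i))
      fun j => Fin.natAdd (M + k) (Fin.rev j)) fun j => Fin.castAdd k (Fin.natAdd M (Fin.rev j)))
    (by
      intro i
      refine Fin.addCases (fun i => Fin.addCases (fun i => ?_) (fun j => ?_) i) (fun j => ?_) i <;>
        simp)

theorem pairSwap_apply (i : Fin (M + k + k)) : pairSwap M k i =
    Fin.addCases (Fin.addCases (fun i => Fin.castAdd k (Fin.castAdd k i))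
      fun j => Fin.natAdd (M + k) (Fin.rev j))
      (fun j => Fin.castAdd k (Fin.natAdd M (Fin.rev j))) i := rfl

theorem append_comp_pairSwap {α : Type*} (z : Fin M → α) (b e : Fin k → α) :
    (fun i => Fin.append (Fin.append z fun j => b (Fin.rev j)) e ((pairSwap M k)⁻¹ i)) =
      Fin.append (Fin.append z fun j => e (Fin.rev j)) b := by
  have hinv : (pairSwap M k)⁻¹ = pairSwap M k := Function.Involutive.toPerm_symm _
  ext1 i
  rw [hinv]
  refine Fin.addCases (fun i => Fin.addCases (fun i => ?_) (fun j => ?_) i) (fun j => ?_) i <;>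
    simp [pairSwap_apply]

/-- A partial transpose on one half of each pair moves to the other half, where the remaining
operator becomes a partial trace. -/
theorem partialTransposeLast_mul_pairInsertion (A : TensorOp (M + k + k) d) :
    partialTransposeLast (M + k) k A * pairInsertion M k d =
      extendOp (M + k) k d (partialTrace (M + k) k d (A * permOp _ d (pairSwap M k))) *
        pairInsertion M k d := by
  ext x z
  obtain ⟨a, b, rfl⟩ := exists_eq_finAppend x
  rw [mul_pairInsertion_apply, mul_pairInsertion_apply]
  simp only [partialTransposeLast_append, extendOp_append, Finset.sum_ite_eq, Finset.mem_univ,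
    if_true, partialTrace_apply, mul_permOp_apply, append_comp_pairSwap]

end PairSwap

/-! ### The operator `V^(k)` and the ideal it generates -/

section IndicatorDyad

variable {n d : ℕ}

open Classical in
/-- The operator `|v⟩⟨v| ⊗ 1`, where `v` is the indicator vector of the condition `P` on the
systems in `S` and the identity acts on the other systems. It has this meaning only when `P x`
depends on the coordinates of `x` in `S` alone. -/
noncomputable def indicatorDyad (S : Set (Fin n)) (P : (Fin n → Fin d) → Prop) : TensorOp n d :=
  Matrix.of fun x y => if P x ∧ P y ∧ Set.EqOn x y Sᶜ then 1 else 0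

open Classical in
theorem indicatorDyad_apply (S : Set (Fin n)) (P : (Fin n → Fin d) → Prop) (x y : Fin n → Fin d) :
    indicatorDyad S P x y = if P x ∧ P y ∧ Set.EqOn x y Sᶜ then 1 else 0 := rfl

theorem indicatorDyad_empty : indicatorDyad ∅ (fun _ => True) = (1 : TensorOp n d) := by
  ext x y
  simp [indicatorDyad_apply, Matrix.one_apply]

open Classical in
theorem eqOn_compl_and_eqOn_compl_iff {κ α : Type*} {S T : Set κ} (hST : Disjoint S T)
    {x w y : κ → α} :
    Set.EqOn x w Sᶜ ∧ Set.EqOn w y Tᶜ ↔ w = S.piecewise y x ∧ Set.EqOn x y (S ∪ T)ᶜ := by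
  constructor
  · rintro ⟨hxw, hwy⟩
    refine ⟨funext fun i => ?_, fun i hi => ?_⟩
    · by_cases hi : i ∈ S
      · rw [Set.piecewise_eq_of_mem _ _ _ hi, hwy (hST.notMem_of_mem_left hi)]
      · rw [Set.piecewise_eq_of_notMem _ _ _ hi, hxw hi]
    · rw [Set.compl_union] at hi
      rw [hxw hi.1, hwy hi.2]
  · rintro ⟨rfl, hxy⟩
    refine ⟨fun i hi => (Set.piecewise_eq_of_notMem _ _ _ hi).symm, fun i hi => ?_⟩
    by_cases hiS : i ∈ S
    · rw [Set.piecewise_eq_of_mem _ _ _ hiS]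
    · rw [Set.piecewise_eq_of_notMem _ _ _ hiS, hxy (by simp [hi, hiS])]

open Classical in
theorem indicatorDyad_mul_indicatorDyad {S T : Set (Fin n)} (hST : Disjoint S T)
    {P Q : (Fin n → Fin d) → Prop} (hP : ∀ {x y}, Set.EqOn x y S → (P x ↔ P y))
    (hQ : ∀ {x y}, Set.EqOn x y T → (Q x ↔ Q y)) :
    indicatorDyad S P * indicatorDyad T Q = indicatorDyad (S ∪ T) fun x => P x ∧ Q x := by
  ext x y
  have hPy : P (S.piecewise y x) ↔ P y := hP fun i hi => Set.piecewise_eq_of_mem _ _ _ hi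
  have hQx : Q (S.piecewise y x) ↔ Q x := hQ fun i hi =>
    Set.piecewise_eq_of_notMem _ _ _ (hST.notMem_of_mem_right hi)
  have unique_middle (w : Fin n → Fin d) :
      ((P x ∧ P w ∧ Set.EqOn x w Sᶜ) ∧ Q w ∧ Q y ∧ Set.EqOn w y Tᶜ) ↔
        w = S.piecewise y x ∧ (P x ∧ Q x) ∧ (P y ∧ Q y) ∧ Set.EqOn x y (S ∪ T)ᶜ := by
    have := eqOn_compl_and_eqOn_compl_iff hST (x := x) (w := w) (y := y)
    constructor
    · rintro ⟨⟨hPx, hPw, hxw⟩, hQw, hQy, hwy⟩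
      obtain ⟨rfl, hxy⟩ := this.1 ⟨hxw, hwy⟩
      exact ⟨rfl, ⟨hPx, hQx.1 hQw⟩, ⟨hPy.1 hPw, hQy⟩, hxy⟩
    · rintro ⟨hw, ⟨hPx, hQx'⟩, ⟨hPy', hQy⟩, hxy⟩
      obtain ⟨hxw, hwy⟩ := this.2 ⟨hw, hxy⟩
      subst hw
      exact ⟨⟨hPx, hPy.2 hPy', hxw⟩, hQx.2 hQx', hQy, hwy⟩
  simp only [Matrix.mul_apply, indicatorDyad_apply, mul_ite, mul_one, mul_zero, ← ite_and,
    and_comm (a := Q _ ∧ _), unique_middle]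
  simp only [ite_and (P := _ = S.piecewise y x), Finset.sum_ite_eq', Finset.mem_univ, if_true]
  congr

theorem partialTranspose_permOp_swap {r s : Fin n} (hrs : r ≠ s) :
    partialTranspose s (permOp n d (swap r s)) = indicatorDyad {r, s} fun x => x r = x s := by
  ext x y
  have hiff : Function.update x s (y s) = (fun i => Function.update y s (x s) (swap r s i)) ↔
      x r = x s ∧ y r = y s ∧ Set.EqOn x y {r, s}ᶜ := by
    constructor
    · intro h
      refine ⟨?_, ?_, fun i hi => ?_⟩
      · simpa [hrs] using congrFun h r
      · simpa [hrs] using (congrFun h s).symm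
      · simp only [Set.mem_compl_iff, Set.mem_insert_iff, Set.mem_singleton_iff, not_or] at hi
        simpa [swap_apply_of_ne_of_ne hi.1 hi.2, hi.2] using congrFun h i
    · rintro ⟨hx, hy, hxy⟩
      ext1 i
      rcases eq_or_ne i r with rfl | hr
      · simp [hrs, hx]
      rcases eq_or_ne i s with rfl | hs
      · simp [hrs, hy]
      simpa [swap_apply_of_ne_of_ne hr hs, hs] using hxy (by simp [hr, hs])
  rw [partialTranspose, Matrix.of_apply, permOp_apply, swap_inv, indicatorDyad_apply]
  congr 1
  exact propext hiff

theorem prod_map_partialTranspose_permOp_swap {ι : Type*} {r s : ι → Fin n}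
    (hr : Function.Injective r) (hs : Function.Injective s) (hrs : ∀ i j, r i ≠ s j) :
    ∀ {l : List ι}, l.Nodup →
    (l.map fun j => partialTranspose (s j) (permOp n d (swap (r j) (s j)))).prod =
      indicatorDyad (⋃ j ∈ l, {r j, s j}) fun x => ∀ j ∈ l, x (r j) = x (s j)
  | [], _ => by simpa using indicatorDyad_empty.symm
  | j :: l, hl => by
    obtain ⟨hj, hl⟩ := List.nodup_cons.1 hl
    have hdisj : Disjoint {r j, s j} (⋃ i ∈ l, {r i, s i}) := by
      simp only [Set.disjoint_iUnion_right, Set.disjoint_insert_left, Set.disjoint_singleton_left,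
        Set.mem_insert_iff, Set.mem_singleton_iff, not_or]
      intro i hi
      have hji : j ≠ i := fun h => hj (h ▸ hi)
      exact ⟨⟨hr.ne hji, hrs j i⟩, (hrs i j).symm, hs.ne hji⟩
    rw [List.map_cons, List.prod_cons, prod_map_partialTranspose_permOp_swap hr hs hrs hl,
      partialTranspose_permOp_swap (hrs j j), indicatorDyad_mul_indicatorDyad hdisj]
    · simp
    · intro x y hxy
      rw [hxy (by simp), hxy (by simp)]
    · intro x y hxy
      refine forall₂_congr fun i hi => ?_
      rw [hxy (Set.mem_biUnion hi (by simp)), hxy (Set.mem_biUnion hi (by simp))]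

end IndicatorDyad

section ContractionOp

variable {M N k d : ℕ}

theorem contractionOp_eq_prod (M k d : ℕ) :
    contractionOp (M + k) k d = ((List.finRange k).map fun j =>
      partialTranspose (Fin.natAdd (M + k) (Fin.rev j)) (permOp (M + k + k) d
        (swap (Fin.castAdd k (Fin.natAdd M j)) (Fin.natAdd (M + k) (Fin.rev j))))).prod := by
  rw [contractionOp, List.ofFn_eq_map]
  congr 2
  ext1 j
  have hr : (⟨M + k - k + j, by omega⟩ : Fin (M + k + k)) = Fin.castAdd k (Fin.natAdd M j) := by
    simp [Fin.ext_iff]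
  have hs : (⟨M + k + k - 1 - j, by omega⟩ : Fin (M + k + k)) =
      Fin.natAdd (M + k) (Fin.rev j) := by
    simp only [Fin.ext_iff, Fin.val_natAdd, Fin.val_rev]
    omega
  rw [hr, hs]

theorem contractionOp_eq_indicatorDyad (M k d : ℕ) :
    contractionOp (M + k) k d =
      indicatorDyad {i | M ≤ (i : ℕ)} fun x =>
        ∀ j : Fin k, x (Fin.castAdd k (Fin.natAdd M j)) = x (Fin.natAdd (M + k) (Fin.rev j)) := by
  have hrs : ∀ i j : Fin k,
      Fin.castAdd k (Fin.natAdd M i) ≠ Fin.natAdd (M + k) (Fin.rev j) := fun i j =>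
    ne_of_lt (by simp [Fin.lt_def]; omega)
  have hpairs : (⋃ j ∈ List.finRange k, {Fin.castAdd k (Fin.natAdd M j),
      Fin.natAdd (M + k) (Fin.rev j)}) = {i : Fin (M + k + k) | M ≤ (i : ℕ)} := by
    ext i
    simp only [Set.mem_iUnion, Set.mem_insert_iff, Set.mem_singleton_iff, List.mem_finRange,
      exists_true_left, Set.mem_ofPred_eq]
    induction i using Fin.addCases with
    | left i =>
      induction i using Fin.addCases with
      | left i => simp [Fin.ext_iff]; omega
      | right j => simp
    | right j => simpa [add_assoc] using ⟨Fin.rev j, Or.inr (by simp)⟩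
  rw [contractionOp_eq_prod, prod_map_partialTranspose_permOp_swap
    (r := fun j => Fin.castAdd k (Fin.natAdd M j)) (s := fun j => Fin.natAdd (M + k) (Fin.rev j))
    ((Fin.castAdd_injective _ _).comp (Fin.natAdd_injective _ _))
    ((Fin.natAdd_injective _ _).comp Fin.rev_injective) hrs (List.nodup_finRange k), hpairs]
  simp

theorem contractionOp_eq_pairInsertion_mul (M k d : ℕ) :
    contractionOp (M + k) k d = pairInsertion M k d * (pairInsertion M k d).conjTranspose := by
  rw [contractionOp_eq_indicatorDyad]
  ext x y
  obtain ⟨a, b, rfl⟩ := exists_eq_finAppend x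
  obtain ⟨u, f, rfl⟩ := exists_eq_finAppend a
  obtain ⟨c, e, rfl⟩ := exists_eq_finAppend y
  obtain ⟨v, g, rfl⟩ := exists_eq_finAppend c
  have heqOn : Set.EqOn (Fin.append (Fin.append u f) b) (Fin.append (Fin.append v g) e)
      {i | M ≤ (i : ℕ)}ᶜ ↔ u = v := by
    refine ⟨fun h => funext fun i => ?_, ?_⟩
    · simpa using h (x := Fin.castAdd k (Fin.castAdd k i)) (by simp)
    · rintro rfl i hi
      obtain ⟨i, rfl⟩ : ∃ j : Fin M, i = Fin.castAdd k (Fin.castAdd k j) :=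
        ⟨⟨i, by simpa using hi⟩, rfl⟩
      simp
  simp only [indicatorDyad_apply, heqOn, Fin.append_left, Fin.append_right, Matrix.mul_apply,
    Matrix.conjTranspose_apply, pairInsertion_append, finAppend_inj, ← funext_iff]
  by_cases hf : f = fun j => b (Fin.rev j) <;> by_cases hg : g = fun j => e (Fin.rev j) <;>
    by_cases huv : u = v <;> simp [hf, hg, huv]

theorem extendOp_mem_partiallyTransposedAlgebra {X : TensorOp N d}
    (hX : X ∈ (permAlgHom N d).range) : extendOp N k d X ∈ partiallyTransposedAlgebra N k d := by
  refine permAlgHom_range_le_of_permOp_mem ((Subalgebra.toSubmodule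
    (partiallyTransposedAlgebra N k d)).comap (extendOp N k d).toLinearMap) (fun σ => ?_) hX
  refine Algebra.subset_adjoin ⟨σ.viaEmbedding (Fin.castAddEmb k), ?_⟩
  change partialTransposeLast N k (permOp (N + k) d _) = extendOp N k d (permOp N d σ)
  rw [← extendOp_permOp, partialTransposeLast_extendOp]

theorem conjTranspose_mem_partiallyTransposedAlgebra {a : TensorOp (N + k) d}
    (ha : a ∈ partiallyTransposedAlgebra N k d) :
    a.conjTranspose ∈ partiallyTransposedAlgebra N k d := by
  induction ha using Algebra.adjoin_induction with
  | mem x hx =>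
    obtain ⟨σ, rfl⟩ := hx
    refine Algebra.subset_adjoin ⟨σ⁻¹, ?_⟩
    rw [partialTransposeLast_conjTranspose, permOp_conjTranspose]
  | algebraMap r =>
    rw [Algebra.algebraMap_eq_smul_one, Matrix.conjTranspose_smul, Matrix.conjTranspose_one]
    exact Subalgebra.smul_mem _ (Subalgebra.one_mem _) _
  | add x y _ _ hx hy => rw [Matrix.conjTranspose_add]; exact Subalgebra.add_mem _ hx hy
  | mul x y _ _ hx hy => rw [Matrix.conjTranspose_mul]; exact Subalgebra.mul_mem _ hy hx

theorem exists_mul_extendOp_mul_pairInsertion {a : TensorOp (M + k + k) d}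
    (ha : a ∈ partiallyTransposedAlgebra (M + k) k d) {Y : TensorOp (M + k) d}
    (hY : Y ∈ (permAlgHom (M + k) d).range) :
    ∃ X ∈ (permAlgHom (M + k) d).range,
      a * (extendOp (M + k) k d Y * pairInsertion M k d) =
        extendOp (M + k) k d X * pairInsertion M k d := by
  induction ha using Algebra.adjoin_induction generalizing Y with
  | mem x hx =>
    obtain ⟨σ, rfl⟩ := hx
    refine ⟨partialTrace (M + k) k d (permOp _ d σ * extendOp (M + k) k d Y *
      permOp _ d (pairSwap M k)), partialTrace_mem_range ?_, ?_⟩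
    · exact mul_mem (mul_mem (permOp_mem_range σ) (extendOp_mem_range hY)) (permOp_mem_range _)
    · rw [← Matrix.mul_assoc, ← partialTransposeLast_mul_extendOp,
        partialTransposeLast_mul_pairInsertion]
  | algebraMap r =>
    refine ⟨r • Y, Subalgebra.smul_mem _ hY r, ?_⟩
    rw [Algebra.algebraMap_eq_smul_one, Matrix.smul_mul, Matrix.one_mul, map_smul, Matrix.smul_mul]
  | add x y _ _ hx hy =>
    obtain ⟨X, hX, hxX⟩ := hx hY
    obtain ⟨Z, hZ, hyZ⟩ := hy hY
    exact ⟨X + Z, add_mem hX hZ, by rw [Matrix.add_mul, hxX, hyZ, map_add, Matrix.add_mul]⟩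
  | mul x y _ _ hx hy =>
    obtain ⟨Z, hZ, hyZ⟩ := hy hY
    obtain ⟨X, hX, hxX⟩ := hx hZ
    exact ⟨X, hX, by rw [Matrix.mul_assoc, hyZ, hxX]⟩

end ContractionOp

/-! ### The operators `E_{ij}` -/

section TensorUnit

open Matrix

variable {m d : ℕ} {ι κ : Type} [Fintype ι] [DecidableEq ι] [Fintype κ] [DecidableEq κ]
  {ρ : Perm (Fin m) →* unitaryGroup ι ℂ} {ρ' : Perm (Fin m) →* unitaryGroup κ ℂ}

/-- The operator by which the matrix unit of an irrep of `S(m)` acts on `(ℂ^d)^{⊗ m}`; it is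
`E_{ij}` before tensoring with the identity on further systems. -/
noncomputable def tensorUnit (d : ℕ) (ρ : Perm (Fin m) →* unitaryGroup ι ℂ) (i j : ι) :
    TensorOp m d :=
  permAlgHom m d (matrixUnit ρ i j)

theorem opE_eq_extendOp_tensorUnit (φ : MatrixFamily) (N k d : ℕ) (μ : YoungDiagram)
    (i j : YoungIndex μ) : opE φ N k d μ i j = extendOp N k d (tensorUnit d (φ N μ) i j) := by
  simp only [opE, tensorUnit, matrixUnit, map_smul, map_sum, permAlgHom_single, extendOp_permOp,
    Fintype.card_perm, Fintype.card_fin]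

theorem tensorUnit_mem_range (ρ : Perm (Fin m) →* unitaryGroup ι ℂ) (i j : ι) :
    tensorUnit d ρ i j ∈ (permAlgHom m d).range :=
  ⟨_, rfl⟩

theorem tensorUnit_conjTranspose (ρ : Perm (Fin m) →* unitaryGroup ι ℂ) (i j : ι) :
    (tensorUnit d ρ i j)ᴴ = tensorUnit d ρ j i := by
  have hentry : ∀ τ, star ((ρ τ⁻¹).1 j i) = (ρ τ).1 i j := by
    intro τ
    rw [map_inv]
    exact star_star _
  simp only [tensorUnit, matrixUnit, map_smul, map_sum, permAlgHom_single, conjTranspose_smul,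
    conjTranspose_sum, permOp_conjTranspose, hentry]
  congr 1
  · simp
  · exact Fintype.sum_equiv (Equiv.inv _) _ _ fun τ => by rw [Equiv.inv_apply, inv_inv]

theorem permOp_mul_tensorUnit (ρ : Perm (Fin m) →* unitaryGroup ι ℂ) (σ : Perm (Fin m))
    (i j : ι) : permOp m d σ * tensorUnit d ρ i j = ∑ k, (ρ σ).1 k i • tensorUnit d ρ k j := by
  have hσ : permOp m d σ = permAlgHom m d (MonoidAlgebra.single σ 1) := by
    rw [permAlgHom_single, one_smul]
  simp only [hσ, tensorUnit, ← map_mul, single_mul_matrixUnit, map_sum, map_smul]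

theorem tensorUnit_mul_permAlgHom (ρ : Perm (Fin m) →* unitaryGroup ι ℂ)
    (x : MonoidAlgebra ℂ (Perm (Fin m))) (i j : ι) :
    tensorUnit d ρ i j * permAlgHom m d x =
      ∑ k, matrixAlgHom ρ x j k • tensorUnit d ρ i k := by
  simp only [tensorUnit, ← map_mul, matrixUnit_mul, map_sum, map_smul]

section IsIrreducible

variable (h : (matrixRep ρ).IsIrreducible)

include h

theorem tensorUnit_mul_tensorUnit (i j k l : ι) :
    tensorUnit d ρ i j * tensorUnit d ρ k l = if j = k then tensorUnit d ρ i l else 0 := by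
  rw [tensorUnit, tensorUnit, ← map_mul, matrixUnit_mul_matrixUnit h, apply_ite (permAlgHom m d),
    map_zero, tensorUnit]

theorem tensorUnit_mul_tensorUnit_same (i j k : ι) :
    tensorUnit d ρ i j * tensorUnit d ρ j k = tensorUnit d ρ i k := by
  rw [tensorUnit_mul_tensorUnit h, if_pos rfl]

theorem tensorUnit_mul_permAlgHom_mul_tensorUnit (x : MonoidAlgebra ℂ (Perm (Fin m)))
    (i j k l : ι) :
    tensorUnit d ρ i j * permAlgHom m d x * tensorUnit d ρ k l =
      matrixAlgHom ρ x j k • tensorUnit d ρ i l := by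
  simp only [tensorUnit, ← map_mul, ← map_smul, matrixUnit_mul_mul_matrixUnit h]

theorem tensorUnit_mul_tensorUnit_of_isEmpty_equiv (h' : (matrixRep ρ').IsIrreducible)
    (hne : IsEmpty (Representation.Equiv (matrixRep ρ) (matrixRep ρ'))) (i j : ι) (k l : κ) :
    tensorUnit d ρ i j * tensorUnit d ρ' k l = 0 := by
  rw [tensorUnit, tensorUnit, ← map_mul, matrixUnit_mul_matrixUnit_of_isEmpty_equiv h h' hne,
    map_zero]

theorem tensorUnit_mul_mul_tensorUnit_of_isEmpty_equiv (h' : (matrixRep ρ').IsIrreducible)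
    (hne : IsEmpty (Representation.Equiv (matrixRep ρ) (matrixRep ρ'))) {Y : TensorOp m d}
    (hY : Y ∈ (permAlgHom m d).range) (i j : ι) (k l : κ) :
    tensorUnit d ρ i j * Y * tensorUnit d ρ' k l = 0 := by
  obtain ⟨y, rfl⟩ := hY
  change permAlgHom m d _ * permAlgHom m d y * permAlgHom m d _ = 0
  rw [← map_mul, ← map_mul, matrixUnit_mul_mul_matrixUnit_of_isEmpty_equiv h h' hne, map_zero]

theorem trace_tensorUnit_of_ne {i j : ι} (hij : i ≠ j) : (tensorUnit d ρ i j).trace = 0 := by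
  rw [← tensorUnit_mul_tensorUnit_same h i i j, trace_mul_comm, tensorUnit_mul_tensorUnit h,
    if_neg hij.symm, trace_zero]

end IsIrreducible

end TensorUnit

section Multiplicity

open Matrix

variable {φ : MatrixFamily} {m d : ℕ} {μ : YoungDiagram}

theorem permAlgHom_mul_of_mem_intertwiners {T : Matrix (Fin m → Fin d) (YoungIndex μ) ℂ}
    (hT : T ∈ intertwiners φ m d μ) (x : MonoidAlgebra ℂ (Perm (Fin m))) :
    permAlgHom m d x * T = T * matrixAlgHom (φ m μ) x := by
  induction x using MonoidAlgebra.induction_on with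
  | of σ => simpa [permAlgHom_single, matrixAlgHom_single] using hT σ
  | add x y hx hy => rw [map_add, map_add, Matrix.add_mul, Matrix.mul_add, hx, hy]
  | smul c x hx => rw [map_smul, map_smul, Matrix.smul_mul, Matrix.mul_smul, hx]

theorem of_tensorUnit_mulVec_mem_intertwiners (φ : MatrixFamily) (i : YoungIndex μ)
    (v : (Fin m → Fin d) → ℂ) :
    Matrix.of (fun x j => (tensorUnit d (φ m μ) j i *ᵥ v) x) ∈ intertwiners φ m d μ := by
  intro σ
  ext x j
  have hact := congrFun (congrArg (· *ᵥ v) (permOp_mul_tensorUnit (d := d) (φ m μ) σ j i)) x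
  simp only [← mulVec_mulVec, sum_mulVec, Finset.sum_apply, smul_mulVec, Pi.smul_apply,
    smul_eq_mul] at hact
  simp only [mul_apply, of_apply, mul_comm _ ((φ m μ σ).1 _ _)]
  exact hact

variable (h : (matrixRep (φ m μ)).IsIrreducible)

include h

theorem tensorUnit_mulVec_col_of_mem_intertwiners
    {T : Matrix (Fin m → Fin d) (YoungIndex μ) ℂ} (hT : T ∈ intertwiners φ m d μ)
    (i j : YoungIndex μ) : tensorUnit d (φ m μ) j i *ᵥ T.col i = T.col j := by
  have hmul : tensorUnit d (φ m μ) j i * T = T * Matrix.single j i (1 : ℂ) := by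
    rw [tensorUnit, permAlgHom_mul_of_mem_intertwiners hT, matrixAlgHom_matrixUnit_self h]
  ext x
  have hentry := congrFun (congrFun hmul x) i
  rwa [mul_single_apply_same, mul_one] at hentry

/-- An intertwiner is determined by its `i`-th column, which may be any vector in the range
of `E_{ii}`. -/
noncomputable def intertwinersEquivRange (d : ℕ) (i : YoungIndex μ) :
    intertwiners φ m d μ ≃ₗ[ℂ] LinearMap.range (toLin' (tensorUnit d (φ m μ) i i)) where
  toFun T := ⟨T.1.col i, T.1.col i, tensorUnit_mulVec_col_of_mem_intertwiners h T.2 i i⟩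
  map_add' _ _ := rfl
  map_smul' _ _ := rfl
  invFun v := ⟨_, of_tensorUnit_mulVec_mem_intertwiners φ i v.1⟩
  left_inv T := by
    ext x j
    exact congrFun (tensorUnit_mulVec_col_of_mem_intertwiners h T.2 i j) x
  right_inv := by
    rintro ⟨_, w, rfl⟩
    refine Subtype.ext ?_
    change tensorUnit d (φ m μ) i i *ᵥ (tensorUnit d (φ m μ) i i *ᵥ w) = _
    rw [mulVec_mulVec, tensorUnit_mul_tensorUnit_same h]
    rfl

theorem trace_tensorUnit_self (i : YoungIndex μ) :
    (tensorUnit d (φ m μ) i i).trace = irrepMultiplicity φ m d μ := by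
  have hidem : IsIdempotentElem (toLin' (tensorUnit d (φ m μ) i i)) := by
    change toLin' _ ∘ₗ toLin' _ = _
    rw [← toLin'_mul, tensorUnit_mul_tensorUnit_same h]
  rw [irrepMultiplicity, (intertwinersEquivRange h d i).finrank_eq, ← trace_toLin'_eq]
  exact ((LinearMap.isProj_range_iff_isIdempotentElem _).2 hidem).trace

open scoped ComplexOrder in
theorem tensorUnit_eq_zero_of_irrepMultiplicity_eq_zero (hzero : irrepMultiplicity φ m d μ = 0)
    (i j : YoungIndex μ) : tensorUnit d (φ m μ) i j = 0 := by
  have hdiag : tensorUnit d (φ m μ) i i = 0 := by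
    rw [← trace_conjTranspose_mul_self_eq_zero_iff, tensorUnit_conjTranspose,
      tensorUnit_mul_tensorUnit_same h, trace_tensorUnit_self h, hzero, Nat.cast_zero]
  rw [← tensorUnit_mul_tensorUnit_same h i i j, hdiag, zero_mul]

end Multiplicity

section ManyRows

variable {m d : ℕ} {μ : YoungDiagram}

theorem permAlgHom_apply_eq_zero_of_mul_swap_eq_neg {x : MonoidAlgebra ℂ (Perm (Fin m))}
    {p q : Fin m} (hx : x * MonoidAlgebra.single (swap p q) 1 = -x) {y : Fin m → Fin d}
    (hy : y p = y q) (z : Fin m → Fin d) : permAlgHom m d x z y = 0 := by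
  have hswap : (fun i => y ((swap p q)⁻¹ i)) = y := by
    funext i
    rw [swap_inv]
    exact apply_swap_eq_self hy i
  have hentry := congrArg (fun w => permAlgHom m d w z y) hx
  simp only [map_mul, permAlgHom_single, one_smul, map_neg, Matrix.neg_apply, mul_permOp_apply,
    hswap] at hentry
  exact self_eq_neg.1 hentry

-- By the pigeonhole principle every basis tensor repeats a factor in the first column.
theorem permAlgHom_colAntisymmetrizer_eq_zero (h : d < μ.colLen 0) (t : Fin m ≃ μ.cells) :
    permAlgHom m d (colAntisymmetrizer t) = 0 := by
  ext z y
  have hmem : ∀ a : Fin (μ.colLen 0), ((a : ℕ), 0) ∈ μ.cells :=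
    fun a => YoungDiagram.mem_iff_lt_colLen.2 a.2
  obtain ⟨a, b, hab, hy⟩ := Fintype.exists_ne_map_eq_of_card_lt
    (fun a : Fin (μ.colLen 0) => y (t.symm ⟨_, hmem a⟩)) (by simpa using h)
  have hne : t.symm ⟨_, hmem a⟩ ≠ t.symm ⟨_, hmem b⟩ := by
    simpa [Fin.ext_iff] using hab
  have hcol := signedSum_mul_single Perm.sign (swap_mem_fiberPerm (f := fun i => (t i).1.2)
    (x := t.symm ⟨_, hmem a⟩) (y := t.symm ⟨_, hmem b⟩) (by simp))
  rw [Perm.sign_swap hne, Units.val_neg, Units.val_one, Int.cast_neg, Int.cast_one,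
    neg_one_smul] at hcol
  exact permAlgHom_apply_eq_zero_of_mul_swap_eq_neg hcol hy z

theorem IsIrrepOfShape.tensorUnit_eq_zero_of_lt_colLen {ι : Type} [Fintype ι] [DecidableEq ι]
    {ρ : Perm (Fin m) →* Matrix.unitaryGroup ι ℂ} (hρ : IsIrrepOfShape μ ρ)
    (h : d < μ.colLen 0) (i j : ι) : tensorUnit d ρ i j = 0 := by
  obtain ⟨t, ht⟩ := hρ.exists_matrixAlgHom_colAntisymmetrizer_ne_zero
  contrapose! ht with hne
  ext p q
  have hsandwich :=
    tensorUnit_mul_permAlgHom_mul_tensorUnit (d := d) hρ.1 (colAntisymmetrizer t) i p q j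
  rw [permAlgHom_colAntisymmetrizer_eq_zero h, mul_zero, zero_mul] at hsandwich
  exact (smul_eq_zero.1 hsandwich.symm).resolve_right hne

end ManyRows

namespace IsPRIR

variable {N M k d : ℕ} {φ : MatrixFamily} (hφ : IsPRIR N φ) (hN : M + k ≤ N)
  {α β μ : YoungDiagram} (hα : α.card = M) (hβ : β.card = M) (hμ : μ.card = M + k)

include hφ hN hα hμ

theorem tensorUnit_mul_extendOp_permOp (r : YoungPath α μ) (i : YoungIndex μ)
    (a : YoungIndex α) (σ : Perm (Fin M)) :
    tensorUnit d (φ (M + k) μ) i (a.comp r) * extendOp M k d (permOp M d σ) =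
      ∑ c, (φ M α σ).1 a c • tensorUnit d (φ (M + k) μ) i (c.comp r) := by
  have hσ : extendOp M k d (permOp M d σ) = permAlgHom (M + k) d
      (MonoidAlgebra.single (σ.viaEmbedding (Fin.castAddEmb k)) 1) := by
    rw [extendOp_permOp, permAlgHom_single, one_smul]
  rw [hσ, tensorUnit_mul_permAlgHom, matrixAlgHom_single, one_smul]
  symm
  refine Finset.sum_of_injOn (fun c : YoungIndex α => c.comp r)
    (YoungPath.comp_left_injective r).injOn (by simp) (fun q _ hq => ?_) fun c _ => ?_
  · rw [hφ.restrict_comp_of_ne hα σ a k r q (fun c hc => hq ⟨c, by simp, hc⟩) hN hμ, zero_smul]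
  · rw [hφ.restrict_comp hα σ a c k r hN hμ]

theorem tensorUnit_mul_extendOp_permAlgHom (r : YoungPath α μ) (i : YoungIndex μ)
    (a : YoungIndex α) (x : MonoidAlgebra ℂ (Perm (Fin M))) :
    tensorUnit d (φ (M + k) μ) i (a.comp r) * extendOp M k d (permAlgHom M d x) =
      ∑ c, matrixAlgHom (φ M α) x a c • tensorUnit d (φ (M + k) μ) i (c.comp r) := by
  induction x using MonoidAlgebra.induction_on with
  | of σ =>
    simpa only [MonoidAlgebra.of_apply, permAlgHom_single, matrixAlgHom_single, one_smul] using
      hφ.tensorUnit_mul_extendOp_permOp hN hα hμ r i a σ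
  | add x y hx hy =>
    simp only [map_add, mul_add, hx, hy, Matrix.add_apply, add_smul, Finset.sum_add_distrib]
  | smul c x hx =>
    simp only [map_smul, mul_smul_comm, hx, Matrix.smul_apply, Finset.smul_sum, smul_smul,
      smul_eq_mul]

theorem tensorUnit_mul_extendOp_tensorUnit (r : YoungPath α μ) (i : YoungIndex μ)
    (a b : YoungIndex α) :
    tensorUnit d (φ (M + k) μ) i (a.comp r) * extendOp M k d (tensorUnit d (φ M α) a b) =
      tensorUnit d (φ (M + k) μ) i (b.comp r) := by
  rw [tensorUnit.eq_1 d (φ M α), hφ.tensorUnit_mul_extendOp_permAlgHom hN hα hμ,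
    matrixAlgHom_matrixUnit_self (hφ.isIrreducible (by omega) hα)]
  simp [Matrix.single_apply, ite_smul]

theorem extendOp_tensorUnit_mul_tensorUnit (r : YoungPath α μ) (i : YoungIndex μ)
    (a b : YoungIndex α) :
    extendOp M k d (tensorUnit d (φ M α) b a) * tensorUnit d (φ (M + k) μ) (a.comp r) i =
      tensorUnit d (φ (M + k) μ) (b.comp r) i := by
  have hadjoint := congrArg Matrix.conjTranspose
    (hφ.tensorUnit_mul_extendOp_tensorUnit (d := d) hN hα hμ r i a b)
  rwa [Matrix.conjTranspose_mul, ← extendOp_conjTranspose, tensorUnit_conjTranspose,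
    tensorUnit_conjTranspose, tensorUnit_conjTranspose] at hadjoint

include hβ in
theorem partialTrace_tensorUnit_eq_mul_mul (r : YoungPath α μ) (s : YoungPath β μ)
    (a : YoungIndex α) (b : YoungIndex β) :
    partialTrace M k d (tensorUnit d (φ (M + k) μ) (a.comp r) (b.comp s)) =
      tensorUnit d (φ M α) a a *
        partialTrace M k d (tensorUnit d (φ (M + k) μ) (a.comp r) (b.comp s)) *
        tensorUnit d (φ M β) b b := by
  rw [← partialTrace_extendOp_mul, ← partialTrace_mul_extendOp,
    hφ.extendOp_tensorUnit_mul_tensorUnit hN hα hμ, hφ.tensorUnit_mul_extendOp_tensorUnit hN hβ hμ]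

include hβ in
theorem partialTrace_tensorUnit_of_ne (hne : α ≠ β) (r : YoungPath α μ) (s : YoungPath β μ)
    (a : YoungIndex α) (b : YoungIndex β) :
    partialTrace M k d (tensorUnit d (φ (M + k) μ) (a.comp r) (b.comp s)) = 0 := by
  have hM : M ≤ N := by omega
  rw [hφ.partialTrace_tensorUnit_eq_mul_mul hN hα hβ hμ]
  exact tensorUnit_mul_mul_tensorUnit_of_isEmpty_equiv (hφ.isIrreducible hM hα)
    (hφ.isIrreducible hM hβ) (hφ.isEmpty_equiv hM hα hβ hne)
    (partialTrace_mem_range (tensorUnit_mem_range _ _ _)) a a b b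

theorem exists_partialTrace_tensorUnit_eq_smul (r s : YoungPath α μ) (a : YoungIndex α) :
    ∃ c : ℂ, partialTrace M k d (tensorUnit d (φ (M + k) μ) (a.comp r) (a.comp s)) =
        c • tensorUnit d (φ M α) a a ∧
      (tensorUnit d (φ (M + k) μ) (a.comp r) (a.comp s)).trace =
        c * irrepMultiplicity φ M d α := by
  have hirr := hφ.isIrreducible (show M ≤ N by omega) hα
  obtain ⟨y, hy⟩ := partialTrace_mem_range
    (tensorUnit_mem_range (d := d) (φ (M + k) μ) (a.comp r) (a.comp s))
  have hscalar : partialTrace M k d (tensorUnit d (φ (M + k) μ) (a.comp r) (a.comp s)) =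
      matrixAlgHom (φ M α) y a a • tensorUnit d (φ M α) a a := by
    rw [hφ.partialTrace_tensorUnit_eq_mul_mul hN hα hα hμ, ← hy]
    exact tensorUnit_mul_permAlgHom_mul_tensorUnit hirr y a a a a
  refine ⟨_, hscalar, ?_⟩
  rw [← trace_partialTrace, hscalar, Matrix.trace_smul, trace_tensorUnit_self hirr, smul_eq_mul]

theorem partialTrace_tensorUnit_of_path_ne {r s : YoungPath α μ} (hrs : r ≠ s)
    (a : YoungIndex α) :
    partialTrace M k d (tensorUnit d (φ (M + k) μ) (a.comp r) (a.comp s)) = 0 := by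
  obtain ⟨c, hc, htrace⟩ := hφ.exists_partialTrace_tensorUnit_eq_smul (d := d) hN hα hμ r s a
  rw [trace_tensorUnit_of_ne (hφ.isIrreducible hN hμ) ((YoungPath.comp_right_injective a).ne hrs),
    zero_eq_mul, Nat.cast_eq_zero] at htrace
  rw [hc]
  rcases htrace with hzero | hzero
  · rw [hzero, zero_smul]
  · rw [tensorUnit_eq_zero_of_irrepMultiplicity_eq_zero (hφ.isIrreducible (by omega) hα) hzero,
      smul_zero]

theorem smul_partialTrace_tensorUnit (r : YoungPath α μ) (a : YoungIndex α) :
    (irrepMultiplicity φ M d α : ℂ) •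
      partialTrace M k d (tensorUnit d (φ (M + k) μ) (a.comp r) (a.comp r)) =
      (irrepMultiplicity φ (M + k) d μ : ℂ) • tensorUnit d (φ M α) a a := by
  obtain ⟨c, hc, htrace⟩ := hφ.exists_partialTrace_tensorUnit_eq_smul (d := d) hN hα hμ r r a
  rw [trace_tensorUnit_self (hφ.isIrreducible hN hμ)] at htrace
  rw [hc, htrace, smul_smul, mul_comm]

end IsPRIR

/-! ### The operators `F_μ(α)` -/

section ProjFactor

open Matrix

variable {φ : MatrixFamily} {one : (α : YoungDiagram) → YoungIndex α} {M k d : ℕ}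
  {α β μ ν : YoungDiagram}

/-- The isometry, up to a scalar factor, from the range of `E^α_{1 1}` onto the range of the
projector `F_{i i}^{r r}`. -/
noncomputable def projFactor (φ : MatrixFamily) (one : (α : YoungDiagram) → YoungIndex α)
    (M k d : ℕ) (r : YoungPath α μ) (i : YoungIndex μ) :
    Matrix (Fin (M + k + k) → Fin d) (Fin M → Fin d) ℂ :=
  extendOp (M + k) k d (tensorUnit d (φ (M + k) μ) i ((one α).comp r)) * pairInsertion M k d

theorem opF_self_eq_smul_projFactor_mul (r : YoungPath α μ) (i : YoungIndex μ) :
    opF φ one (M + k) k d r r i i =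
      ((irrepMultiplicity φ M d α : ℂ) / irrepMultiplicity φ (M + k) d μ) •
        (projFactor φ one M k d r i * (projFactor φ one M k d r i)ᴴ) := by
  rw [opF, Real.sqrt_mul_self (Nat.cast_nonneg _), Nat.add_sub_cancel,
    contractionOp_eq_pairInsertion_mul, opE_eq_extendOp_tensorUnit, opE_eq_extendOp_tensorUnit,
    projFactor, conjTranspose_mul, ← extendOp_conjTranspose, tensorUnit_conjTranspose]
  push_cast
  simp only [Matrix.mul_assoc]

theorem projF_conjTranspose (α μ : YoungDiagram) :
    (projF φ one (M + k) k d α μ)ᴴ = projF φ one (M + k) k d α μ := by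
  simp [projF, opF_self_eq_smul_projFactor_mul, conjTranspose_sum]

theorem projFactor_conjTranspose_mul (r : YoungPath α μ) (s : YoungPath β ν) (i : YoungIndex μ)
    (j : YoungIndex ν) :
    (projFactor φ one M k d r i)ᴴ * projFactor φ one M k d s j =
      partialTrace M k d (tensorUnit d (φ (M + k) μ) ((one α).comp r) i *
        tensorUnit d (φ (M + k) ν) j ((one β).comp s)) := by
  rw [← pairInsertion_conjTranspose_mul_extendOp_mul, map_mul, projFactor, projFactor,
    conjTranspose_mul, ← extendOp_conjTranspose, tensorUnit_conjTranspose]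
  simp only [Matrix.mul_assoc]

variable (hφ : IsPRIR (M + k) φ) (hα : α.card = M) (hβ : β.card = M) (hμ : μ.card = M + k)
  (hν : ν.card = M + k)

include hφ hα hμ

include hβ hν in
theorem projFactor_conjTranspose_mul_of_ne (hne : (α, μ) ≠ (β, ν)) (r : YoungPath α μ)
    (s : YoungPath β ν) (i : YoungIndex μ) (j : YoungIndex ν) :
    (projFactor φ one M k d r i)ᴴ * projFactor φ one M k d s j = 0 := by
  have hirr := hφ.isIrreducible le_rfl hμ
  rw [projFactor_conjTranspose_mul]
  rcases eq_or_ne μ ν with rfl | hμν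
  · have hαβ : α ≠ β := fun h => hne (by rw [h])
    rw [tensorUnit_mul_tensorUnit hirr]
    split_ifs
    · exact hφ.partialTrace_tensorUnit_of_ne le_rfl hα hβ hμ hαβ r s _ _
    · exact map_zero _
  · rw [tensorUnit_mul_tensorUnit_of_isEmpty_equiv hirr (hφ.isIrreducible le_rfl hν)
      (hφ.isEmpty_equiv le_rfl hμ hν hμν), map_zero]

theorem projFactor_conjTranspose_mul_of_index_ne {r s : YoungPath α μ} {i j : YoungIndex μ}
    (hne : (r, i) ≠ (s, j)) :
    (projFactor φ one M k d r i)ᴴ * projFactor φ one M k d s j = 0 := by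
  rw [projFactor_conjTranspose_mul, tensorUnit_mul_tensorUnit (hφ.isIrreducible le_rfl hμ)]
  split_ifs with hij
  · subst hij
    exact hφ.partialTrace_tensorUnit_of_path_ne le_rfl hα hμ (fun h => hne (by rw [h])) _
  · exact map_zero _

theorem smul_projFactor_conjTranspose_mul_self (r : YoungPath α μ) (i : YoungIndex μ) :
    (irrepMultiplicity φ M d α : ℂ) •
      ((projFactor φ one M k d r i)ᴴ * projFactor φ one M k d r i) =
      (irrepMultiplicity φ (M + k) d μ : ℂ) • tensorUnit d (φ M α) (one α) (one α) := by
  rw [projFactor_conjTranspose_mul,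
    tensorUnit_mul_tensorUnit_same (hφ.isIrreducible le_rfl hμ),
    hφ.smul_partialTrace_tensorUnit le_rfl hα hμ]

theorem projFactor_mul_tensorUnit (r : YoungPath α μ) (i : YoungIndex μ) (a : YoungIndex α) :
    projFactor φ one M k d r i * tensorUnit d (φ M α) (one α) a =
      extendOp (M + k) k d (tensorUnit d (φ (M + k) μ) i (a.comp r)) * pairInsertion M k d := by
  rw [projFactor, Matrix.mul_assoc, ← extendOp_extendOp_mul_pairInsertion, ← Matrix.mul_assoc,
    ← map_mul, hφ.tensorUnit_mul_extendOp_tensorUnit le_rfl hα hμ]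

theorem opF_self_mul_projFactor (r : YoungPath α μ) (i : YoungIndex μ) :
    opF φ one (M + k) k d r r i i * projFactor φ one M k d r i = projFactor φ one M k d r i := by
  rcases eq_or_ne (irrepMultiplicity φ (M + k) d μ) 0 with hzero | hpos
  · rw [projFactor, tensorUnit_eq_zero_of_irrepMultiplicity_eq_zero
      (hφ.isIrreducible le_rfl hμ) hzero, map_zero, Matrix.zero_mul, Matrix.mul_zero]
  · rw [opF_self_eq_smul_projFactor_mul, Matrix.smul_mul, Matrix.mul_assoc, div_eq_inv_mul,
      mul_smul, ← Matrix.mul_smul, smul_projFactor_conjTranspose_mul_self hφ hα hμ,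
      Matrix.mul_smul, smul_smul, inv_mul_cancel₀ (Nat.cast_ne_zero.2 hpos), one_smul,
      projFactor_mul_tensorUnit hφ hα hμ, projFactor]

theorem opF_self_mul_projFactor_of_index_ne {r s : YoungPath α μ} {i j : YoungIndex μ}
    (hne : (r, i) ≠ (s, j)) :
    opF φ one (M + k) k d r r i i * projFactor φ one M k d s j = 0 := by
  rw [opF_self_eq_smul_projFactor_mul, Matrix.smul_mul, Matrix.mul_assoc,
    projFactor_conjTranspose_mul_of_index_ne hφ hα hμ hne, Matrix.mul_zero, smul_zero]

theorem projF_mul_projFactor (r : YoungPath α μ) (i : YoungIndex μ) :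
    projF φ one (M + k) k d α μ * projFactor φ one M k d r i = projFactor φ one M k d r i := by
  simp only [projF, Matrix.sum_mul]
  rw [← Fintype.sum_prod_type', Finset.sum_eq_single_of_mem (r, i) (Finset.mem_univ _)
    fun _ _ hne => opF_self_mul_projFactor_of_index_ne hφ hα hμ hne]
  exact opF_self_mul_projFactor hφ hα hμ r i

include hβ hν in
theorem projF_mul_projFactor_of_ne (hne : (α, μ) ≠ (β, ν)) (s : YoungPath β ν)
    (j : YoungIndex ν) :
    projF φ one (M + k) k d α μ * projFactor φ one M k d s j = 0 := by
  simp only [projF, opF_self_eq_smul_projFactor_mul, Matrix.sum_mul, Matrix.smul_mul,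
    Matrix.mul_assoc, projFactor_conjTranspose_mul_of_ne hφ hα hβ hμ hν hne, Matrix.mul_zero,
    smul_zero, Finset.sum_const_zero]

include hβ hν in
theorem projF_mul_projF_of_ne (hne : (α, μ) ≠ (β, ν)) :
    projF φ one (M + k) k d α μ * projF φ one (M + k) k d β ν = 0 := by
  rw [projF.eq_1 φ one (M + k) k d β ν]
  simp only [opF_self_eq_smul_projFactor_mul, Matrix.mul_sum, Matrix.mul_smul, ← Matrix.mul_assoc,
    projF_mul_projFactor_of_ne hφ hα hβ hμ hν hne, Matrix.zero_mul, smul_zero,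
    Finset.sum_const_zero]

theorem projF_mul_self :
    projF φ one (M + k) k d α μ * projF φ one (M + k) k d α μ = projF φ one (M + k) k d α μ := by
  conv_lhs => arg 2; rw [projF]
  simp only [opF_self_eq_smul_projFactor_mul, Matrix.mul_sum, Matrix.mul_smul,
    ← Matrix.mul_assoc, projF_mul_projFactor hφ hα hμ]
  simp only [projF, opF_self_eq_smul_projFactor_mul]

theorem isStarProjection_projF : IsStarProjection (projF φ one (M + k) k d α μ) :=
  ⟨projF_mul_self hφ hα hμ, projF_conjTranspose α μ⟩

end ProjFactor

/-! ### The identity of the ideal -/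

section SumProjF

open Matrix

variable {φ : MatrixFamily} {one : (α : YoungDiagram) → YoungIndex α} {M k d : ℕ}

theorem mem_youngDiagramsAbove {α μ : YoungDiagram} {m d : ℕ} :
    μ ∈ youngDiagramsAbove α m d ↔ (μ.card = m ∧ μ.colLen 0 ≤ d) ∧ α ≤ μ := by
  simp only [youngDiagramsAbove, Finset.mem_filter, mem_youngDiagrams]

theorem colLen_le_colLen_of_le {α μ : YoungDiagram} (h : α ≤ μ) (j : ℕ) :
    α.colLen j ≤ μ.colLen j := by
  by_contra! hlt
  exact lt_irrefl _ (YoungDiagram.mem_iff_lt_colLen.1 (h (YoungDiagram.mem_iff_lt_colLen.2 hlt)))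

theorem sumProjF_conjTranspose :
    (sumProjF φ one (M + k) k d)ᴴ = sumProjF φ one (M + k) k d := by
  simp only [sumProjF, conjTranspose_sum, projF_conjTranspose]

theorem sumProjF_mul_projFactor (hφ : IsPRIR (M + k) φ) {α μ : YoungDiagram} (hα : α.card = M)
    (hμ : μ.card = M + k) (hd : μ.colLen 0 ≤ d) (r : YoungPath α μ) (i : YoungIndex μ) :
    sumProjF φ one (M + k) k d * projFactor φ one M k d r i = projFactor φ one M k d r i := by
  have hαd : α.colLen 0 ≤ d := (colLen_le_colLen_of_le r.le 0).trans hd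
  rw [sumProjF, Nat.add_sub_cancel, Matrix.sum_mul,
    Finset.sum_eq_single_of_mem α (mem_youngDiagrams.2 ⟨hα, hαd⟩), Matrix.sum_mul,
    Finset.sum_eq_single_of_mem μ (mem_youngDiagramsAbove.2 ⟨⟨hμ, hd⟩, r.le⟩)]
  · exact projF_mul_projFactor hφ hα hμ r i
  · intro ν hν hne
    exact projF_mul_projFactor_of_ne hφ hα hα (mem_youngDiagramsAbove.1 hν).1.1 hμ
      (fun h => hne (Prod.mk.inj h).2) r i
  · intro β hβ hne
    rw [Matrix.sum_mul]
    refine Finset.sum_eq_zero fun ν hν => ?_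
    exact projF_mul_projFactor_of_ne hφ (mem_youngDiagrams.1 hβ).1 hα
      (mem_youngDiagramsAbove.1 hν).1.1 hμ (fun h => hne (Prod.mk.inj h).1) r i

theorem sumProjF_mul_extendOp_tensorUnit_mul_pairInsertion (hφ : IsPRIR (M + k) φ)
    {μ : YoungDiagram} (hμ : μ.card = M + k) (i j : YoungIndex μ) :
    sumProjF φ one (M + k) k d *
        (extendOp (M + k) k d (tensorUnit d (φ (M + k) μ) i j) * pairInsertion M k d) =
      extendOp (M + k) k d (tensorUnit d (φ (M + k) μ) i j) * pairInsertion M k d := by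
  rcases lt_or_ge d (μ.colLen 0) with hd | hd
  · rw [(hφ.irrep _ μ le_rfl hμ).tensorUnit_eq_zero_of_lt_colLen hd, map_zero, Matrix.zero_mul,
      Matrix.mul_zero]
  · obtain ⟨α, a, r, hα, rfl⟩ := j.exists_eq_comp (M := M) (Nat.zero_le _) (by omega)
    rw [← projFactor_mul_tensorUnit (one := one) hφ hα hμ, ← Matrix.mul_assoc,
      sumProjF_mul_projFactor hφ hα hμ hd]

theorem sumProjF_mul_extendOp_mul_pairInsertion (hφ : IsPRIR (M + k) φ) {X : TensorOp (M + k) d}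
    (hX : X ∈ (permAlgHom (M + k) d).range) :
    sumProjF φ one (M + k) k d * (extendOp (M + k) k d X * pairInsertion M k d) =
      extendOp (M + k) k d X * pairInsertion M k d := by
  obtain ⟨x, rfl : permAlgHom (M + k) d x = X⟩ := hX
  have hx : x ∈ Submodule.span ℂ {x | ∃ μ ∈ youngDiagrams (M + k) (M + k), ∃ i j,
      x = matrixUnit (φ (M + k) μ) i j} := by
    rw [hφ.span_matrixUnit le_rfl]
    exact Submodule.mem_top
  induction hx using Submodule.span_induction with
  | mem x hx =>
    obtain ⟨μ, hμ, i, j, rfl⟩ := hx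
    exact sumProjF_mul_extendOp_tensorUnit_mul_pairInsertion hφ (mem_youngDiagrams_self.1 hμ) i j
  | zero => simp only [map_zero, Matrix.zero_mul, Matrix.mul_zero]
  | add x y _ _ hx hy => simp only [map_add, Matrix.add_mul, Matrix.mul_add, hx, hy]
  | smul c x _ hx => simp only [map_smul, Matrix.smul_mul, Matrix.mul_smul, hx]

theorem sumProjF_mul_of_mem_maximalIdeal (hφ : IsPRIR (M + k) φ) {x : TensorOp (M + k + k) d}
    (hx : x ∈ maximalIdeal (M + k) k d) : sumProjF φ one (M + k) k d * x = x := by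
  induction hx using Submodule.span_induction with
  | mem x hx =>
    obtain ⟨a, ha, b, -, rfl⟩ := hx
    obtain ⟨X, hX, haW⟩ := exists_mul_extendOp_mul_pairInsertion ha (Subalgebra.one_mem _)
    rw [map_one, Matrix.one_mul] at haW
    rw [contractionOp_eq_pairInsertion_mul, ← Matrix.mul_assoc a, haW, Matrix.mul_assoc (_ * _),
      ← Matrix.mul_assoc, sumProjF_mul_extendOp_mul_pairInsertion hφ hX]
  | zero => exact mul_zero _
  | add x y _ _ hx hy => rw [mul_add, hx, hy]
  | smul c x _ hx => rw [mul_smul_comm, hx]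

theorem contractionOp_conjTranspose :
    (contractionOp (M + k) k d)ᴴ = contractionOp (M + k) k d := by
  rw [contractionOp_eq_pairInsertion_mul, conjTranspose_mul, conjTranspose_conjTranspose]

theorem conjTranspose_mem_maximalIdeal {x : TensorOp (M + k + k) d}
    (hx : x ∈ maximalIdeal (M + k) k d) : xᴴ ∈ maximalIdeal (M + k) k d := by
  induction hx using Submodule.span_induction with
  | mem x hx =>
    obtain ⟨a, ha, b, hb, rfl⟩ := hx
    refine Submodule.subset_span ⟨_, conjTranspose_mem_partiallyTransposedAlgebra hb, _,
      conjTranspose_mem_partiallyTransposedAlgebra ha, ?_⟩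
    rw [conjTranspose_mul, conjTranspose_mul, contractionOp_conjTranspose, Matrix.mul_assoc]
  | zero => rw [conjTranspose_zero]; exact Submodule.zero_mem _
  | add x y _ _ hx hy => rw [conjTranspose_add]; exact Submodule.add_mem _ hx hy
  | smul c x _ hx => rw [conjTranspose_smul]; exact Submodule.smul_mem _ _ hx

theorem mul_sumProjF_of_mem_maximalIdeal (hφ : IsPRIR (M + k) φ) {x : TensorOp (M + k + k) d}
    (hx : x ∈ maximalIdeal (M + k) k d) : x * sumProjF φ one (M + k) k d = x := by
  have hadjoint := congrArg conjTranspose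
    (sumProjF_mul_of_mem_maximalIdeal (one := one) hφ (conjTranspose_mem_maximalIdeal hx))
  rwa [conjTranspose_mul, conjTranspose_conjTranspose, sumProjF_conjTranspose] at hadjoint

theorem sumProjF_mem_maximalIdeal (N : ℕ) : sumProjF φ one N k d ∈ maximalIdeal N k d := by
  have hmem : ∀ (μ : YoungDiagram) (i j : YoungIndex μ),
      opE φ N k d μ i j ∈ partiallyTransposedAlgebra N k d := by
    intro μ i j
    rw [opE_eq_extendOp_tensorUnit]
    exact extendOp_mem_partiallyTransposedAlgebra (tensorUnit_mem_range _ _ _)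
  exact Submodule.sum_mem _ fun α _ => Submodule.sum_mem _ fun μ _ => Submodule.sum_mem _
    fun r _ => Submodule.sum_mem _ fun i _ => Submodule.smul_mem _ _
      (Submodule.subset_span ⟨_, hmem _ _ _, _, hmem _ _ _, rfl⟩)

end SumProjF

theorem mainTheorem10 (N k d : ℕ) (hk : k ≤ N) (φ : MatrixFamily) (hφ : IsPRIR N φ)
    (one : (α : YoungDiagram) → YoungIndex α) :
    (∀ α ∈ youngDiagrams (N - k) d, ∀ μ ∈ youngDiagramsAbove α N d,
      IsStarProjection (projF φ one N k d α μ)) ∧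
    (∀ α ∈ youngDiagrams (N - k) d, ∀ μ ∈ youngDiagramsAbove α N d,
      ∀ β ∈ youngDiagrams (N - k) d, ∀ ν ∈ youngDiagramsAbove β N d,
        (α, μ) ≠ (β, ν) → projF φ one N k d α μ * projF φ one N k d β ν = 0) ∧
    sumProjF φ one N k d ∈ maximalIdeal N k d ∧
    ∀ x ∈ maximalIdeal N k d,
      sumProjF φ one N k d * x = x ∧ x * sumProjF φ one N k d = x := by
  obtain ⟨M, rfl⟩ := Nat.exists_eq_add_of_le' hk
  rw [Nat.add_sub_cancel]
  refine ⟨fun α hα μ hμ => ?_, fun α hα μ hμ β hβ ν hν hne => ?_, sumProjF_mem_maximalIdeal _,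
    fun x hx => ⟨sumProjF_mul_of_mem_maximalIdeal hφ hx, mul_sumProjF_of_mem_maximalIdeal hφ hx⟩⟩
  · exact isStarProjection_projF hφ (mem_youngDiagrams.1 hα).1 (mem_youngDiagramsAbove.1 hμ).1.1
  · exact projF_mul_projF_of_ne hφ (mem_youngDiagrams.1 hα).1 (mem_youngDiagrams.1 hβ).1
      (mem_youngDiagramsAbove.1 hμ).1.1 (mem_youngDiagramsAbove.1 hν).1.1 hne
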